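/- **Setting.** For every value $k\in\mathbb N$ of the security parameter let $f=f(k)$ be bounded by a polynomial in $k$ and $n=3f+1$. There are $n$ parties, of which at most $f$ are faulty and behave arbitrarily. The network is asynchronous, authenticated and reliable: messages between honest parties are eventually delivered, in an order chosen by the adversary, and honest parties perform every action that stays enabled. Let $(\mathrm{Enc},\mathrm{DecShare},\mathrm{Dec})$ be a correct and robust threshold encryption scheme with threshold $f+1$ (any $f+1$ verified shares of a well-formed ciphertext decrypt it, always to the same plaintext, which is $v$ for an encryption of $v$; malformed ciphertexts have no shares), and let external validity of a message (a ciphertext) be well-formedness together with an arbitrary fixed predicate. A party may or may not have an input $v$; if an honest party has one, its ciphertext is externally valid. An adversary induces, for each $k$, a probability distribution on executions. **Slim-ABC (one instance).** Each honest party $p_i$ does the following. 1. It runs committee selection (CS) and obtains a committee $C$. 2. If $p_i\in C$ and it has an input $v$, it invokes the prioritized provable broadcast (pPB) on $m=\mathrm{Enc}(v)$; when this returns a proof $\rho$, it multicasts $(\mathrm{PROPOSAL},i,m,\rho)$ and $(\mathrm{SUGGESTION},i,m,\rho)$. Otherwise, on the first proposal or suggestion $(l,m,\rho)$ with valid proof,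 it multicasts $(\mathrm{SUGGESTION},l,m,\rho)$. 3. On a suggestion $(l,m,\rho)$ with valid proof it counts the sender and, if it has not yet voted in ABBA-Invocation$_l$, votes $1$ there with $(m,\rho)$. After suggestions from $2f+1$ distinct parties it votes $0$ in ABBA-Invocation$_l$ for all $l\in C$ in which it has not voted. 4. ABBA-Invocation$_l$: the vote is multicast; having voted, the party counts the votes of $2f+1$ distinct parties (a vote $1$ counts only with a valid proof), and inputs to the binary agreement ABBA$_l$ the bit $1$ if its own vote or some counted vote is $1$, else $0$. If ABBA$_l$ outputs $0$, it returns no value. If ABBA$_l$ outputs $1$, the party fetches $m$ with its proof from another party if it lacks it, multicasts its decryption share, and returns the plaintext obtained from $f+1$ valid shares. 5. When it has counted $2f+1$ suggestions and ABBA-Invocation$_l$ has returned for all $l\in C$, it outputs the set $V$ of the returned values. **Assumptions on the sub-protocols.** They are black boxes which, except with negligible probability (uniformly over the instances $l$), satisfy in the execution: * *CS.* If at least $f+1$ honest parties participate, each participating honest party outputs a committee; honest parties output the same committee; it has $f+1$ members. * *pPB* (instance with sender $l$). Integrity: an honest party delivers at most once. Validity: delivered messages are externally valid. Provability: if valid proofs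 for $m$ and $m'$ are sent by anybody, then $m=m'$ and at least $f+1$ honest parties delivered $m$. Termination: if $l$ is honest and invokes it with an externally valid $m$, all honest parties deliver $m$ and $l$ obtains a valid proof for $m$. Selectedness: if an honest party delivers $m$, then $l$ is in its committee, and if $l$ is honest then $l$ invoked pPB with $m$. * *ABBA biased towards 1* (instance $l$). Agreement: honest outputs are equal. Termination: if all honest parties input a bit, all output a bit. Validity: the output of an honest party is the input of some honest party. Bias: if at least $f+1$ honest parties input $1$, no honest party outputs $0$. **Theorem.** Under these assumptions each of the following holds except with negligible probability. * *Agreement.* If an honest party outputs a set $V$, then every honest party outputs $V$. * *Validity.* If an honest party outputs $V$, then $|V|\ge 1$, and every $v\in V$ is the decryption of an externally valid message, with a valid pPB proof, of a member $l$ of its committee; if $l$ is honest, $v$ is the input of $l$. * *Totality.* If some honest committee member has an input, then every honest party produces an output. -/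

import Mathlib

open MeasureTheory

noncomputable section

namespace SlimABC

/-- The `n = 3f + 1` parties. -/
abbrev Party (f : ℕ) : Type := Fin (3 * f + 1)

/-! ## Threshold encryption -/

/-- The algorithms of an `(f + 1)`-out-of-`n` threshold encryption scheme. `IsKeySetup pk sk` says
that `(pk, sk)` is a possible output of the key generation; `decShare` returns `none` on a malformed
ciphertext; `dec` combines decryption shares, given as a partial function on the parties. -/
structure ThresholdEncryption (f : ℕ) where
  PK : Type
  SK : Type
  Coins : Type
  Plain : Type
  Cipher : Type
  Share : Type
  IsKeySetup : PK → (Party f → SK) → Prop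
  enc : PK → Plain → Coins → Cipher
  WellFormed : PK → Cipher → Prop
  decShare : SK → Cipher → Option Share
  VerifyShare : PK → Cipher → Party f → Share → Prop
  dec : PK → Cipher → (Party f → Option Share) → Option Plain

namespace ThresholdEncryption

variable {f : ℕ}

/-- A family of shares of at least `f + 1` parties, all of which pass verification. -/
def ValidShares (E : ThresholdEncryption f) (pk : E.PK) (c : E.Cipher)
    (s : Party f → Option E.Share) : Prop :=
  f + 1 ≤ (Finset.univ.filter fun j => (s j).isSome = true).card ∧
    ∀ j σ, s j = some σ → E.VerifyShare pk c j σ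

/-- Correctness of the scheme: encryption produces well-formed ciphertexts, key holders produce
valid shares exactly of the well-formed ones, any valid family of shares of a well-formed ciphertext
decrypts it, always to the same plaintext, and for an encryption of `v` that plaintext is `v`. -/
structure Correct (E : ThresholdEncryption f) : Prop where
  enc_wellFormed : ∀ pk sk v r, E.IsKeySetup pk sk → E.WellFormed pk (E.enc pk v r)
  decShare_isSome : ∀ pk sk c j, E.IsKeySetup pk sk →
    ((E.decShare (sk j) c).isSome = true ↔ E.WellFormed pk c)
  decShare_verify : ∀ pk sk c j σ, E.IsKeySetup pk sk →
    E.decShare (sk j) c = some σ → E.VerifyShare pk c j σ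
  dec_isSome : ∀ pk sk c s, E.IsKeySetup pk sk → E.WellFormed pk c → E.ValidShares pk c s →
    (E.dec pk c s).isSome = true
  dec_unique : ∀ pk sk c s s', E.IsKeySetup pk sk → E.ValidShares pk c s → E.ValidShares pk c s' →
    E.dec pk c s = E.dec pk c s'
  dec_enc : ∀ pk sk v r s, E.IsKeySetup pk sk → E.ValidShares pk (E.enc pk v r) s →
    E.dec pk (E.enc pk v r) s = some v

end ThresholdEncryption

/-! ## Messages, local states and events -/

section Model

variable {f : ℕ}

/-- The messages of the protocol; `l` is the committee member concerned. A `V`-message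
`vote l msg` is a vote for `1` carrying a proposal and its proof if `msg` is `some (m, ρ)`, and a
vote for `0` if it is `none`. `fetch` and `reply` retrieve a ciphertext that a party lacks. -/
inductive Payload (E : ThresholdEncryption f) (Proof : Type) : Type where
  | proposal (l : Party f) (m : E.Cipher) (ρ : Proof)
  | suggestion (l : Party f) (m : E.Cipher) (ρ : Proof)
  | vote (l : Party f) (msg : Option (E.Cipher × Proof))
  | fetch (l : Party f)
  | reply (l : Party f) (m : E.Cipher) (ρ : Proof)
  | share (l : Party f) (σ : E.Share)

/-- The message contains the proposal `m` of `l` together with `ρ`. -/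
def Payload.Carries {E : ThresholdEncryption f} {Proof : Type} (l : Party f) (m : E.Cipher)
    (ρ : Proof) : Payload E Proof → Prop
  | .proposal l' m' ρ' => l' = l ∧ m' = m ∧ ρ' = ρ
  | .suggestion l' m' ρ' => l' = l ∧ m' = m ∧ ρ' = ρ
  | .vote l' msg => l' = l ∧ msg = some (m, ρ)
  | .fetch _ => False
  | .reply l' m' ρ' => l' = l ∧ m' = m ∧ ρ' = ρ
  | .share _ _ => False

/-- The variables of the ABBA-Invocation of one committee member `l` at one party. -/
structure Inst (E : ThresholdEncryption f) (Proof : Type) : Type where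
  /-- the bit with which ABBA-Invocation was invoked -/
  vote : Option Bool := none
  /-- the parties whose `V`-messages have been counted -/
  voters : Finset (Party f) := ∅
  u : Bool := false
  msg : Option (E.Cipher × Proof) := none
  abbaIn : Option Bool := none
  abbaOut : Option Bool := none
  fetched : Bool := false
  shareSent : Bool := false
  shares : Party f → Option E.Share := fun _ => none
  /-- `none`: not returned; `some none`: returned without a value; `some (some v)`: returned `v` -/
  ret : Option (Option E.Plain) := none

/-- The local state of an honest party in one instance of Slim-ABC. -/
structure LocalState (E : ThresholdEncryption f) (Proof : Type) : Type where
  started : Bool := false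
  committee : Option (Finset (Party f)) := none
  pbIn : Option E.Cipher := none
  pbReturned : Bool := false
  suggested : Bool := false
  /-- the parties whose suggestions have been counted -/
  suggestFrom : Finset (Party f) := ∅
  inst : Party f → Inst E Proof := fun _ => {}
  output : Option (Finset E.Plain) := none

/-- The events at an honest party. `committee`, `pbReturn`, `pbDeliver` and `abbaOut` are the
outputs of the sub-protocols, `start`, `pbInvoke` and `abbaIn` are the inputs to them. -/
inductive Event (E : ThresholdEncryption f) (Proof : Type) : Type where
  | start
  | committee (C : Finset (Party f))
  | pbInvoke (m : E.Cipher)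
  | pbReturn (ρ : Proof)
  | pbDeliver (l : Party f) (m : E.Cipher)
  | receive (j : Party f) (p : Payload E Proof)
  | voteZero (l : Party f)
  | abbaIn (l : Party f) (b : Bool)
  | abbaOut (l : Party f) (b : Bool)
  | fetch (l : Party f)
  | share (l : Party f) (σ : E.Share)
  | combine (l : Party f) (v : E.Plain)
  | output (V : Finset E.Plain)

/-- A step of the system: an event at an honest party, or a faulty party `j` sending an arbitrary
message to `i`, or nothing. -/
inductive Act (E : ThresholdEncryption f) (Proof : Type) : Type where
  | honest (i : Party f) (e : Event E Proof)
  | inject (j i : Party f) (p : Payload E Proof)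
  | idle

/-- The local states, the packets `(sender, receiver, message)` sent so far, and those processed by
their receiver. -/
structure GlobalState (E : ThresholdEncryption f) (Proof : Type) : Type where
  loc : Party f → LocalState E Proof := fun _ => {}
  sent : Set (Party f × Party f × Payload E Proof) := ∅
  rcvd : Set (Party f × Party f × Payload E Proof) := ∅

/-- The data that are fixed during an execution. `verify l m ρ` is the public verification of the
pPB proof (threshold signature) `ρ` for the message `m` of `l`. -/
structure Config (E : ThresholdEncryption f) (Proof : Type) : Type where
  pk : E.PK
  sk : Party f → E.SK
  verify : Party f → E.Cipher → Proof → Prop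
  faulty : Finset (Party f)
  input : Party f → Option E.Plain
  coins : Party f → E.Coins

variable {E : ThresholdEncryption f} {Proof : Type}

/-! ## The protocol of an honest party -/

/-- The messages (receiver, content) of a multi-cast of `p`. -/
def multicast (p : Payload E Proof) : Set (Party f × Payload E Proof) := {x | x.2 = p}

def LocalState.setInst (s : LocalState E Proof) (l : Party f) (x : Inst E Proof) :
    LocalState E Proof :=
  { s with inst := Function.update s.inst l x }

namespace Config

variable (cfg : Config E Proof)

/-- `i` knows that it is selected and has an input: it then runs pPB and suggests its own proposal,
instead of waiting for the proposal of somebody else. -/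
def Proposes (i : Party f) (s : LocalState E Proof) : Prop :=
  (∃ C, s.committee = some C ∧ i ∈ C) ∧ (cfg.input i).isSome = true

open scoped Classical in
/-- Suggest the proposal of `l`, unless a suggestion has been sent or `i` suggests its own. -/
def relay (i : Party f) (s : LocalState E Proof) (l : Party f) (m : E.Cipher) (ρ : Proof) :
    LocalState E Proof × Set (Party f × Payload E Proof) :=
  if s.suggested = false ∧ ¬ cfg.Proposes i s then
    ({ s with suggested := true }, multicast (.suggestion l m ρ))
  else (s, ∅)

open scoped Classical in
def onProposal (i : Party f) (s : LocalState E Proof) (l : Party f) (m : E.Cipher) (ρ : Proof) :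
    LocalState E Proof × Set (Party f × Payload E Proof) :=
  if cfg.verify l m ρ then cfg.relay i s l m ρ else (s, ∅)

open scoped Classical in
/-- Count the suggestion of `j`, relay it, and vote `1` for `l` if no vote has been cast. -/
def onSuggestion (i j : Party f) (s : LocalState E Proof) (l : Party f) (m : E.Cipher) (ρ : Proof) :
    LocalState E Proof × Set (Party f × Payload E Proof) :=
  if cfg.verify l m ρ then
    let r := cfg.relay i { s with suggestFrom := insert j s.suggestFrom } l m ρ
    if (s.inst l).vote = none then
      (r.1.setInst l { s.inst l with vote := some true, u := true, msg := some (m, ρ) },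
        r.2 ∪ multicast (.vote l (some (m, ρ))))
    else r
  else (s, ∅)

open scoped Classical in
/-- Count the vote of `j`; a vote for `1` counts only with a valid proof, and switches `u` to `1`. -/
def onVote (j : Party f) (s : LocalState E Proof) (l : Party f) :
    Option (E.Cipher × Proof) → LocalState E Proof
  | none => s.setInst l { s.inst l with voters := insert j (s.inst l).voters }
  | some (m, ρ) =>
    if cfg.verify l m ρ then
      s.setInst l { s.inst l with
        voters := insert j (s.inst l).voters, u := true, msg := some (m, ρ) }
    else s

/-- Answer the request of `j` for the ciphertext of `l`. -/
def onFetch (j : Party f) (s : LocalState E Proof) (l : Party f) :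
    Set (Party f × Payload E Proof) :=
  {x | ∃ m ρ, (s.inst l).msg = some (m, ρ) ∧ x = (j, .reply l m ρ)}

open scoped Classical in
def onReply (s : LocalState E Proof) (l : Party f) (m : E.Cipher) (ρ : Proof) :
    LocalState E Proof :=
  if cfg.verify l m ρ ∧ (s.inst l).msg = none then
    s.setInst l { s.inst l with msg := some (m, ρ) }
  else s

open scoped Classical in
/-- Store the first valid decryption share of `j`. -/
def onShare (j : Party f) (s : LocalState E Proof) (l : Party f) (σ : E.Share) :
    LocalState E Proof :=
  if (∃ m ρ, (s.inst l).msg = some (m, ρ) ∧ E.VerifyShare cfg.pk m j σ) ∧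
      (s.inst l).shares j = none then
    s.setInst l { s.inst l with shares := Function.update (s.inst l).shares j (some σ) }
  else s

/-- Messages are buffered until the receiver has reached the part of the protocol they belong to. -/
def Ready (s : LocalState E Proof) : Payload E Proof → Prop
  | .proposal _ _ _ => s.committee.isSome = true
  | .suggestion _ _ _ => s.committee.isSome = true
  | .vote l _ => (s.inst l).vote.isSome = true
  | .fetch l => (s.inst l).msg.isSome = true
  | .reply l _ _ => (s.inst l).abbaOut = some true
  | .share l _ => (s.inst l).abbaOut = some true ∧ (s.inst l).msg.isSome = true

/-- When an event may occur at the honest party `i` in local state `s`. The outputs of the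
sub-protocols are restricted only in that a call returns at most once, and only after it was made. -/
def Enabled (i : Party f) (s : LocalState E Proof) : Event E Proof → Prop
  | .start => s.started = false
  | .committee _ => s.started = true ∧ s.committee = none
  | .pbInvoke m => s.pbIn = none ∧ (∃ C, s.committee = some C ∧ i ∈ C) ∧
      ∃ v, cfg.input i = some v ∧ m = E.enc cfg.pk v (cfg.coins i)
  | .pbReturn _ => s.pbIn.isSome = true ∧ s.pbReturned = false
  | .pbDeliver _ _ => True
  | .receive _ p => Ready s p
  | .voteZero l => (∃ C, s.committee = some C ∧ l ∈ C) ∧ 2 * f + 1 ≤ s.suggestFrom.card ∧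
      (s.inst l).vote = none
  | .abbaIn l b => (s.inst l).vote.isSome = true ∧ 2 * f + 1 ≤ (s.inst l).voters.card ∧
      (s.inst l).abbaIn = none ∧ b = (s.inst l).u
  | .abbaOut l _ => (s.inst l).abbaIn.isSome = true ∧ (s.inst l).abbaOut = none
  | .fetch l => (s.inst l).abbaOut = some true ∧ (s.inst l).msg = none ∧
      (s.inst l).fetched = false
  | .share l σ => (s.inst l).abbaOut = some true ∧ (s.inst l).shareSent = false ∧
      ∃ m ρ, (s.inst l).msg = some (m, ρ) ∧ E.decShare (cfg.sk i) m = some σ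
  | .combine l v => (s.inst l).abbaOut = some true ∧ (s.inst l).ret = none ∧
      f + 1 ≤ (Finset.univ.filter fun j => ((s.inst l).shares j).isSome = true).card ∧
      ∃ m ρ, (s.inst l).msg = some (m, ρ) ∧ E.dec cfg.pk m (s.inst l).shares = some v
  | .output V => s.output = none ∧ 2 * f + 1 ≤ s.suggestFrom.card ∧
      ∃ C, s.committee = some C ∧ (∀ l ∈ C, (s.inst l).ret.isSome = true) ∧
        ∀ v, v ∈ V ↔ ∃ l ∈ C, (s.inst l).ret = some (some v)

/-- The effect of an event at `i`: the new local state and the messages sent. -/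
def effect (i : Party f) (s : LocalState E Proof) :
    Event E Proof → LocalState E Proof × Set (Party f × Payload E Proof)
  | .start => ({ s with started := true }, ∅)
  | .committee C => ({ s with committee := some C }, ∅)
  | .pbInvoke m => ({ s with pbIn := some m }, ∅)
  | .pbReturn ρ =>
    match s.pbIn with
    | none => (s, ∅)
    | some m => ({ s with pbReturned := true, suggested := true },
        multicast (.proposal i m ρ) ∪ multicast (.suggestion i m ρ))
  | .pbDeliver _ _ => (s, ∅)
  | .receive _ (.proposal l m ρ) => cfg.onProposal i s l m ρ
  | .receive j (.suggestion l m ρ) => cfg.onSuggestion i j s l m ρ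
  | .receive j (.vote l msg) => (cfg.onVote j s l msg, ∅)
  | .receive j (.fetch l) => (s, onFetch j s l)
  | .receive _ (.reply l m ρ) => (cfg.onReply s l m ρ, ∅)
  | .receive j (.share l σ) => (cfg.onShare j s l σ, ∅)
  | .voteZero l =>
    (s.setInst l { s.inst l with vote := some false, u := false, msg := none },
      multicast (.vote l none))
  | .abbaIn l b => (s.setInst l { s.inst l with abbaIn := some b }, ∅)
  | .abbaOut l b =>
    (s.setInst l { s.inst l with
      abbaOut := some b, ret := if b = true then (s.inst l).ret else some none }, ∅)
  | .fetch l => (s.setInst l { s.inst l with fetched := true }, multicast (.fetch l))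
  | .share l σ => (s.setInst l { s.inst l with shareSent := true }, multicast (.share l σ))
  | .combine l v => (s.setInst l { s.inst l with ret := some (some v) }, ∅)
  | .output V => ({ s with output := some V }, ∅)

/-! ## Executions -/

/-- Which steps the system can make. Channels are authenticated: a received packet was sent. -/
def CanStep (g : GlobalState E Proof) : Act E Proof → Prop
  | .honest i e => i ∉ cfg.faulty ∧ cfg.Enabled i (g.loc i) e ∧
      ∀ j p, e = .receive j p → (j, i, p) ∈ g.sent ∧ (j, i, p) ∉ g.rcvd
  | .inject j _ _ => j ∈ cfg.faulty
  | .idle => True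

def next (g : GlobalState E Proof) : Act E Proof → GlobalState E Proof
  | .honest i e =>
    { loc := Function.update g.loc i (cfg.effect i (g.loc i) e).1
      sent := g.sent ∪ {x | x.1 = i ∧ x.2 ∈ (cfg.effect i (g.loc i) e).2}
      rcvd := g.rcvd ∪ {x | x.2.1 = i ∧ e = .receive x.1 x.2.2} }
  | .inject j i p => { g with sent := insert (j, i, p) g.sent }
  | .idle => g

/-- The events that an honest party is bound to perform once they stay possible. The reception of
packets is guaranteed only for honest senders, and the outputs of the sub-protocols are not
guaranteed at all. -/
def Obligatory : Event E Proof → Prop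
  | .committee _ => False
  | .pbReturn _ => False
  | .pbDeliver _ _ => False
  | .abbaOut _ _ => False
  | .receive j _ => j ∉ cfg.faulty
  | _ => True

/-- External validity of the message `m` of `l`: a well-formed ciphertext that satisfies the
predicate `Q` of the application. -/
def ExternallyValid (Q : Party f → E.Cipher → Prop) (l : Party f) (m : E.Cipher) : Prop :=
  E.WellFormed cfg.pk m ∧ Q l m

end Config

/-- A complete execution of one instance of Slim-ABC, with at most `f` faulty parties, in which the
inputs of honest parties are externally valid. Scheduling, the messages of faulty parties and the
behaviour of the sub-protocols at their interfaces are arbitrary; `fair` says that the network is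
reliable and that honest parties carry out their protocol. An adversary, together with the coins of
the parties and of the sub-protocols, induces for each value of the security parameter a
probability distribution on such executions. -/
structure Run (E : ThresholdEncryption f) (Proof : Type) (Q : Party f → E.Cipher → Prop)
    extends Config E Proof where
  keys : E.IsKeySetup pk sk
  faulty_card : faulty.card ≤ f
  input_valid : ∀ i v, i ∉ faulty → input i = some v →
    toConfig.ExternallyValid Q i (E.enc pk v (coins i))
  act : ℕ → Act E Proof
  state : ℕ → GlobalState E Proof
  init : state 0 = {}
  canStep : ∀ t, toConfig.CanStep (state t) (act t)
  step : ∀ t, state (t + 1) = toConfig.next (state t) (act t)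
  fair : ∀ i e t, i ∉ faulty → toConfig.Obligatory e →
    (∀ t', t ≤ t' → toConfig.CanStep (state t') (.honest i e)) →
    ∃ t', t ≤ t' ∧ act t' = .honest i e

namespace Run

variable {Q : Party f → E.Cipher → Prop} (R : Run E Proof Q)

def Honest (i : Party f) : Prop := i ∉ R.faulty

/-- The event `e` occurs at party `i`. -/
def Occurs (i : Party f) (e : Event E Proof) : Prop := ∃ t, R.act t = .honest i e

/-- Somebody sends a valid pPB proof `ρ` for the message `m` of `l`. -/
def Produced (l : Party f) (m : E.Cipher) (ρ : Proof) : Prop :=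
  R.verify l m ρ ∧ ∃ t i j p, (i, j, p) ∈ (R.state t).sent ∧ p.Carries l m ρ

/-! ## Security of the sub-protocols -/

open scoped Classical in
/-- The number of honest parties at which `e` occurs. -/
def honestCount (e : Event E Proof) : ℕ :=
  (Finset.univ.filter fun i => R.Honest i ∧ R.Occurs i e).card

/-- Committee selection with committees of size `f + 1`. (That a committee contains an honest party
follows from its size; uniformity and unpredictability of the committee are not assumed.) -/
structure CommitteeSecure : Prop where
  termination : f + 1 ≤ R.honestCount .start →
    ∀ i, R.Honest i → R.Occurs i .start → ∃ C, R.Occurs i (.committee C)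
  agreement : ∀ i j C C', R.Honest i → R.Honest j →
    R.Occurs i (.committee C) → R.Occurs j (.committee C') → C = C'
  validity : ∀ i C, R.Honest i → R.Occurs i (.committee C) → C.card = f + 1

/-- The pPB instance with sender `l`. (Slim-ABC never abandons an instance, so abandonability is
void and termination needs no condition about it.) -/
structure PBSecure (l : Party f) : Prop where
  integrity : ∀ i m m' t t', R.Honest i → R.act t = .honest i (.pbDeliver l m) →
    R.act t' = .honest i (.pbDeliver l m') → t = t'
  validity : ∀ i m, R.Honest i → R.Occurs i (.pbDeliver l m) → R.ExternallyValid Q l m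
  provability : ∀ m m' ρ ρ', R.Produced l m ρ → R.Produced l m' ρ' →
    m = m' ∧ f + 1 ≤ R.honestCount (.pbDeliver l m)
  termination : ∀ m, R.Honest l → R.Occurs l (.pbInvoke m) → R.ExternallyValid Q l m →
    (∀ i, R.Honest i → R.Occurs i (.pbDeliver l m)) ∧
      ∃ ρ, R.Occurs l (.pbReturn ρ) ∧ R.verify l m ρ
  selected : ∀ i m, R.Honest i → R.Occurs i (.pbDeliver l m) →
    (∃ C, R.Occurs i (.committee C) ∧ l ∈ C) ∧ (R.Honest l → R.Occurs l (.pbInvoke m))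

/-- The instance of ABBA (biased towards `1`) for the proposal of `l`. (That all honest parties
output as soon as one does is not part of `agreement` here, which makes the assumption weaker.) -/
structure ABBASecure (l : Party f) : Prop where
  agreement : ∀ i j b b', R.Honest i → R.Honest j →
    R.Occurs i (.abbaOut l b) → R.Occurs j (.abbaOut l b') → b = b'
  termination : (∀ i, R.Honest i → ∃ b, R.Occurs i (.abbaIn l b)) →
    ∀ i, R.Honest i → ∃ b, R.Occurs i (.abbaOut l b)
  validity : ∀ i b, R.Honest i → R.Occurs i (.abbaOut l b) →
    ∃ j, R.Honest j ∧ R.Occurs j (.abbaIn l b)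
  biased : f + 1 ≤ R.honestCount (.abbaIn l true) →
    ∀ i b, R.Honest i → R.Occurs i (.abbaOut l b) → b = true

/-! ## The properties of the validated asynchronous common subset -/

/-- If an honest party outputs `V`, then every honest party outputs `V`. -/
def Agreement : Prop :=
  ∀ i V, R.Honest i → R.Occurs i (.output V) → ∀ j, R.Honest j → R.Occurs j (.output V)

/-- An output `V` is non-empty, and each of its elements is the decryption of an externally valid
message, with a valid proof, of a selected party `l`; if `l` is honest, the element is its input. -/
def Validity : Prop :=
  ∀ i V, R.Honest i → R.Occurs i (.output V) → 1 ≤ V.card ∧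
    ∀ v ∈ V, ∃ C l m ρ, R.Occurs i (.committee C) ∧ l ∈ C ∧ R.Produced l m ρ ∧
      R.ExternallyValid Q l m ∧ E.dec R.pk m (fun j => E.decShare (R.sk j) m) = some v ∧
      (R.Honest l → R.input l = some v)

/-- If some honest selected party has an input, then every honest party produces an output. -/
def Totality : Prop :=
  (∃ i C, R.Honest i ∧ R.Occurs i (.committee C) ∧ i ∈ C ∧ (R.input i).isSome = true) →
    ∀ j, R.Honest j → ∃ V, R.Occurs j (.output V)

end Run

end Model

/-! ## Negligible probability -/

/-- `ν` decreases faster than the inverse of every polynomial. -/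
def Negligible (ν : ℕ → ℝ) : Prop :=
  Asymptotics.SuperpolynomialDecay Filter.atTop (fun k : ℕ => (k : ℝ)) ν

/-- The events `P k` hold except with negligible probability. -/
def ExceptNegligible {Ω : ℕ → Type} [∀ k, MeasurableSpace (Ω k)] (μ : ∀ k, Measure (Ω k))
    (P : ∀ k, Ω k → Prop) : Prop :=
  Negligible fun k => (μ k).real {ω | ¬ P k ω}

/-- For every instance `l`, the events `P k l` hold except with negligible probability, with a bound
that does not depend on the instance. -/
def EachExceptNegligible {f : ℕ → ℕ} {Ω : ℕ → Type} [∀ k, MeasurableSpace (Ω k)]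
    (μ : ∀ k, Measure (Ω k)) (P : ∀ k, Party (f k) → Ω k → Prop) : Prop :=
  ∃ ν, Negligible ν ∧ ∀ k l, (μ k).real {ω | ¬ P k l ω} ≤ ν k

end SlimABC

end

/-! Probability enters only through a union bound: there are polynomially many instances, so except
with negligible probability committee selection and all instances of pPB and ABBA behave as
specified (`Run.Secure`). For each such execution the three properties are proved deterministically.

Liveness. Suggestions are contagious (`Secure.suggests_of_suggests`): an honest party that receives
a suggestion with a valid proof relays it, has suggested before, or runs its own pPB, which
terminates and makes it suggest. At least `2f + 1` parties are honest, so once all of them suggest,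
the waits for suggestions and for votes end and ABBA terminates in every instance of the committee.
If ABBA decides `1`, some honest party input `1` and so holds the proposal; the others fetch it, and
the honest shares decrypt it (`Secure.eventually_ret`). Thus one honest suggestion with a valid
proof makes every honest party output. It is supplied by an honest committee member with an input
(totality), and also by any honest output, because `2f + 1` counted suggestions include an honest
one.

Agreement. The result of an instance does not depend on the party: ABBA fixes whether there is a
value, provability fixes the ciphertext, and uniqueness of decryption fixes the plaintext
(`Secure.ret_unique`).

Non-emptiness. When an honest party first has `2f + 1` suggestions it has not yet voted `0`
anywhere, so it has voted `1` for whatever the honest parties among their senders suggested. By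
double counting (`exists_heard`) some honest `p` is among the counted senders of `f + 1` honest
parties. The proposal suggested by `p` thus gets `f + 1` honest votes `1`, which meet every set of
`2f + 1` voters; all honest inputs to that ABBA are `1`, and it decides `1`
(`Secure.exists_abbaOut_true`). -/

namespace SlimABC

variable {f : ℕ} {E : ThresholdEncryption f} {Proof : Type}

/-! ## Steps of one party -/

@[simp] theorem LocalState.inst_setInst (s : LocalState E Proof) (l l' : Party f)
    (x : Inst E Proof) : (s.setInst l x).inst l' = if l' = l then x else s.inst l' := by
  simp [LocalState.setInst, Function.update_apply]

/-- Facts about the variables of one ABBA-Invocation that hold in every reachable state. -/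
structure Inst.Inv (x : Inst E Proof) : Prop where
  vote_of_msg : x.msg.isSome = true → x.vote.isSome = true
  msg_of_u : x.u = true → x.msg.isSome = true
  u_of_vote : x.vote = some true → x.u = true
  vote_of_abbaIn : x.abbaIn.isSome = true → x.vote.isSome = true
  u_of_abbaIn : x.abbaIn = some true → x.u = true
  abbaIn_of_abbaOut : x.abbaOut.isSome = true → x.abbaIn.isSome = true
  abbaOut_of_ret : ∀ r, x.ret = some r → x.abbaOut = some r.isSome
  ret_of_abbaOut : x.abbaOut = some false → x.ret = some none

/-- `y` extends `x`: variables that are set once keep their value, counters only grow. -/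
structure Inst.Le (x y : Inst E Proof) : Prop where
  vote : ∀ b, x.vote = some b → y.vote = some b
  voters : x.voters ⊆ y.voters
  u : x.u = true → y.u = true
  msg : x.msg.isSome = true → y.msg.isSome = true
  abbaIn : ∀ b, x.abbaIn = some b → y.abbaIn = some b
  abbaOut : ∀ b, x.abbaOut = some b → y.abbaOut = some b
  fetched : x.fetched = true → y.fetched = true
  shareSent : x.shareSent = true → y.shareSent = true
  shares : ∀ j σ, x.shares j = some σ → y.shares j = some σ
  ret : ∀ r, x.ret = some r → y.ret = some r

theorem Inst.Le.refl (x : Inst E Proof) : x.Le x := by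
  constructor <;> simp

theorem Inst.Le.trans {x y z : Inst E Proof} (h : x.Le y) (h' : y.Le z) : x.Le z := by
  obtain ⟨⟩ := h
  obtain ⟨⟩ := h'
  constructor <;> grind

/-- Facts about the local state of `i` that hold in every reachable state. -/
structure LocalState.Inv (cfg : Config E Proof) (i : Party f) (s : LocalState E Proof) : Prop where
  inst : ∀ l, (s.inst l).Inv
  proposes : s.pbIn.isSome = true → cfg.Proposes i s
  pbIn_of_pbReturned : s.pbReturned = true → s.pbIn.isSome = true
  suggested_of_pbReturned : s.pbReturned = true → s.suggested = true
  committee_of_suggested : s.suggested = true → s.committee.isSome = true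
  pbReturned_of_suggested : s.suggested = true → cfg.Proposes i s → s.pbReturned = true

/-- `s'` extends `s`. -/
structure LocalState.Le (s s' : LocalState E Proof) : Prop where
  inst : ∀ l, (s.inst l).Le (s'.inst l)
  started : s.started = true → s'.started = true
  committee : ∀ C, s.committee = some C → s'.committee = some C
  pbIn : ∀ m, s.pbIn = some m → s'.pbIn = some m
  pbReturned : s.pbReturned = true → s'.pbReturned = true
  suggested : s.suggested = true → s'.suggested = true
  suggestFrom : s.suggestFrom ⊆ s'.suggestFrom
  output : ∀ V, s.output = some V → s'.output = some V

theorem LocalState.Le.refl (s : LocalState E Proof) : s.Le s := by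
  constructor <;> simp [Inst.Le.refl]

theorem LocalState.Le.trans {s s' s'' : LocalState E Proof} (h : s.Le s') (h' : s'.Le s'') :
    s.Le s'' := by
  have := fun l => (h.inst l).trans (h'.inst l)
  obtain ⟨⟩ := h
  obtain ⟨⟩ := h'
  constructor <;> grind

theorem LocalState.Le.setInst {s : LocalState E Proof} {l : Party f} {x : Inst E Proof}
    (h : (s.inst l).Le x) : s.Le (s.setInst l x) := by
  constructor <;> try simp [LocalState.setInst]
  intro l'
  by_cases hl : l' = l
  · subst hl; simpa using h
  · simpa [hl] using Inst.Le.refl _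

/-! ### Monotonicity and invariance under one event. -/

namespace Config

variable (cfg : Config E Proof)

theorem relay_le (i : Party f) (s : LocalState E Proof) (l : Party f) (m : E.Cipher) (ρ : Proof) :
    s.Le (cfg.relay i s l m ρ).1 := by
  unfold relay; split
  · constructor <;> simp [Inst.Le.refl]
  · exact .refl _

@[simp] theorem relay_inst (i : Party f) (s : LocalState E Proof) (l : Party f) (m : E.Cipher)
    (ρ : Proof) : (cfg.relay i s l m ρ).1.inst = s.inst := by
  unfold relay; split <;> rfl

/-- The invariant is needed because a vote for `0` resets `u` and `msg`, and a negative ABBA output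
overwrites `ret`. Before a vote `u` and `msg` still have their default values, since counting is
buffered until the vote; before an ABBA output there is no `ret`. A later vote may replace `msg` by
another pair, which is why the order records only that it is present. -/
theorem le_effect {i : Party f} {s : LocalState E Proof} {e : Event E Proof}
    (hs : s.Inv cfg i) (he : cfg.Enabled i s e) : s.Le (cfg.effect i s e).1 := by
  have hi := hs.inst
  cases e with
  | receive j p =>
    cases p with
    | proposal l m ρ =>
      simp only [effect, onProposal]; split
      · exact cfg.relay_le ..
      · exact .refl _
    | suggestion l m ρ =>
      simp only [effect, onSuggestion]; split
      · refine LocalState.Le.trans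
          (s' := (cfg.relay i { s with suggestFrom := insert j s.suggestFrom } l m ρ).1) ?_ ?_
        · refine .trans ?_ (cfg.relay_le ..)
          constructor <;> simp [Inst.Le.refl]
        · split
          · apply LocalState.Le.setInst
            have := hi l
            obtain ⟨⟩ := this
            constructor <;> simp_all
          · exact .refl _
      · exact .refl _
    | vote l msg =>
      rcases msg with _ | ⟨m, ρ⟩ <;> simp only [effect, onVote]
      · apply LocalState.Le.setInst; constructor <;> simp
      · split
        · apply LocalState.Le.setInst; constructor <;> simp
        · exact .refl _
    | fetch l => exact .refl _
    | reply l m ρ =>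
      simp only [effect, onReply]; split
      · apply LocalState.Le.setInst; constructor <;> simp
      · exact .refl _
    | share l σ =>
      simp only [effect, onShare]; split
      · apply LocalState.Le.setInst; constructor <;> simp [Function.update_apply]
        grind
      · exact .refl _
  | pbReturn ρ =>
    simp only [effect]; split
    · exact .refl _
    · constructor <;> simp [Inst.Le.refl]
  | pbDeliver l m => exact .refl _
  | start => constructor <;> simp [effect, Inst.Le.refl]
  | committee C => constructor <;> simp_all [effect, Inst.Le.refl, Enabled]
  | pbInvoke m => constructor <;> simp_all [effect, Inst.Le.refl, Enabled]
  | output V => constructor <;> simp_all [effect, Inst.Le.refl, Enabled]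
  | voteZero l | abbaIn l b | abbaOut l b | fetch l | share l b | combine l b =>
    simp only [effect]
    apply LocalState.Le.setInst
    have := hi l
    obtain ⟨⟩ := this
    constructor <;> simp_all [Enabled]

theorem inv_setInst {i : Party f} {s : LocalState E Proof} {l : Party f} {x : Inst E Proof}
    (hs : s.Inv cfg i) (hx : x.Inv) : (s.setInst l x).Inv cfg i := by
  obtain ⟨hi⟩ := hs
  constructor <;> simp_all [LocalState.setInst, Proposes, Function.update_apply]
  intro l'; split <;> simp_all

theorem inv_relay {i : Party f} {s : LocalState E Proof} (l : Party f) (m : E.Cipher) (ρ : Proof)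
    (hs : s.Inv cfg i) (hc : s.committee.isSome = true) : (cfg.relay i s l m ρ).1.Inv cfg i := by
  unfold relay; split
  · obtain ⟨⟩ := hs
    constructor <;> simp_all [Proposes]
  · exact hs

/-- The delicate clause is `pbReturned_of_suggested`. A proposing party never relays, and a party
cannot become a proposer after relaying, because nothing is suggested before the committee is known.
Hence a proposer suggests only when its pPB returns. -/
theorem inv_effect {i : Party f} {s : LocalState E Proof} {e : Event E Proof}
    (hs : s.Inv cfg i) (he : cfg.Enabled i s e) : (cfg.effect i s e).1.Inv cfg i := by
  have hi := hs.inst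
  cases e with
  | receive j p =>
    cases p with
    | proposal l m ρ =>
      simp only [effect, onProposal]; split
      · exact cfg.inv_relay _ _ _ hs he
      · exact hs
    | suggestion l m ρ =>
      simp only [effect, onSuggestion]; split
      · have h : (cfg.relay i
            { s with suggestFrom := insert j s.suggestFrom } l m ρ).1.Inv cfg i := by
          refine cfg.inv_relay _ _ _ ?_ he
          obtain ⟨⟩ := hs
          constructor <;> simp_all [Proposes]
        split
        · apply inv_setInst _ h
          have := hi l
          obtain ⟨⟩ := this
          constructor <;> simp_all
        · exact h
      · exact hs
    | vote l msg =>
      have := hi l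
      obtain ⟨⟩ := this
      simp only [Enabled, Ready] at he
      rcases msg with _ | ⟨m, ρ⟩ <;> simp only [effect, onVote]
      · apply inv_setInst _ hs; constructor <;> simp_all
      · split
        · apply inv_setInst _ hs; constructor <;> simp_all
        · exact hs
    | fetch l => exact hs
    | reply l m ρ =>
      have := hi l
      obtain ⟨⟩ := this
      simp only [Enabled, Ready] at he
      simp only [effect, onReply]; split
      · apply inv_setInst _ hs; constructor <;> simp_all
      · exact hs
    | share l σ =>
      have := hi l
      obtain ⟨⟩ := this
      simp only [effect, onShare]; split
      · apply inv_setInst _ hs; constructor <;> simp_all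
      · exact hs
  | pbReturn ρ =>
    simp only [effect]; split
    · exact hs
    · obtain ⟨⟩ := hs
      simp only [Enabled] at he
      constructor <;> simp_all [Proposes]
      grind
  | pbDeliver l m => exact hs
  | start | committee C | pbInvoke m | output V =>
    obtain ⟨⟩ := hs
    simp only [Enabled] at he
    constructor <;> simp_all [effect, Proposes] <;> grind
  | voteZero l | abbaIn l b | abbaOut l b | fetch l | share l b | combine l b =>
    simp only [effect]
    apply inv_setInst _ hs
    have := hi l
    obtain ⟨⟩ := this
    constructor <;> simp_all [Enabled] <;> grind

/-! ### Messages sent and variables changed by one event. -/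

theorem mem_relay {i : Party f} {s : LocalState E Proof} {l : Party f} {m : E.Cipher} {ρ : Proof}
    {x : Party f × Payload E Proof} (h : x ∈ (cfg.relay i s l m ρ).2) :
    s.suggested = false ∧ ¬ cfg.Proposes i s ∧ x.2 = .suggestion l m ρ ∧
      (cfg.relay i s l m ρ).1.suggested = true := by
  unfold relay at h ⊢
  split at h <;> simp_all [multicast]

/-- Every message but a reply is multicast. -/
theorem mem_effect_all {i k : Party f} {s : LocalState E Proof} {e : Event E Proof}
    {p : Payload E Proof} (h : (k, p) ∈ (cfg.effect i s e).2)
    (hp : ∀ l m ρ, p ≠ .reply l m ρ) (k' : Party f) : (k', p) ∈ (cfg.effect i s e).2 := by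
  unfold effect at h ⊢
  split at h <;> try split at h
  all_goals simp_all [onProposal, onSuggestion, relay, multicast, onFetch]
  all_goals grind

/-- How a suggestion comes to be sent. -/
theorem mem_effect_suggestion {i k : Party f} {s : LocalState E Proof} {e : Event E Proof}
    {l : Party f} {m : E.Cipher} {ρ : Proof}
    (h : (k, Payload.suggestion l m ρ) ∈ (cfg.effect i s e).2) :
    (cfg.effect i s e).1.suggested = true ∧
      ((e = .pbReturn ρ ∧ l = i ∧ s.pbIn = some m) ∨
        (cfg.verify l m ρ ∧ s.suggested = false ∧ ¬ cfg.Proposes i s ∧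
          ∃ j, e = .receive j (.proposal l m ρ) ∨ e = .receive j (.suggestion l m ρ))) := by
  cases e with
  | receive j p =>
    cases p with
    | suggestion l' m' ρ' =>
      simp only [effect, onSuggestion] at h ⊢
      split at h
      · rename_i hv
        have key : (k, Payload.suggestion l m ρ) ∈
            (cfg.relay i { s with suggestFrom := insert j s.suggestFrom } l' m' ρ').2 := by
          split at h
          · simpa [multicast] using h
          · exact h
        obtain ⟨h1, h2, h3, h4⟩ := cfg.mem_relay key
        simp only [Payload.suggestion.injEq] at h3
        obtain ⟨rfl, rfl, rfl⟩ := h3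
        refine ⟨?_, .inr ⟨hv, h1, h2, j, .inr rfl⟩⟩
        simp only [hv, if_true]
        split <;> exact h4
      · simp at h
    | proposal l' m' ρ' =>
      simp only [effect, onProposal] at h ⊢
      split at h
      · rename_i hv
        obtain ⟨h1, h2, h3, h4⟩ := cfg.mem_relay h
        simp only [Payload.suggestion.injEq] at h3
        obtain ⟨rfl, rfl, rfl⟩ := h3
        refine ⟨?_, .inr ⟨hv, h1, h2, j, .inl rfl⟩⟩
        simpa only [hv, if_true] using h4
      · simp at h
    | vote | fetch | reply | share => simp [effect, onFetch] at h
  | pbReturn ρ' =>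
    simp only [effect] at h ⊢
    split at h <;> simp_all [multicast]
  | _ => simp [effect, multicast] at h

/-- How a vote comes to be sent. -/
theorem mem_effect_vote {i k : Party f} {s : LocalState E Proof} {e : Event E Proof}
    {l : Party f} {msg : Option (E.Cipher × Proof)}
    (h : (k, Payload.vote l msg) ∈ (cfg.effect i s e).2) :
    ((cfg.effect i s e).1.inst l).vote = some msg.isSome ∧
      ∀ m ρ, msg = some (m, ρ) → cfg.verify l m ρ := by
  cases e with
  | receive j p =>
    cases p with
    | suggestion l' m' ρ' =>
      simp only [effect, onSuggestion] at h ⊢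
      split at h
      · rename_i hv
        split at h
        · rename_i hn
          rcases h with h | h
          · simpa using (cfg.mem_relay h).2.2.1
          · simp only [multicast, Set.mem_ofPred_eq, Payload.vote.injEq] at h
            obtain ⟨rfl, rfl⟩ := h
            simp [hv, hn]
        · simpa using (cfg.mem_relay h).2.2.1
      · simp at h
    | proposal l' m' ρ' =>
      simp only [effect, onProposal] at h ⊢
      split at h
      · simpa using (cfg.mem_relay h).2.2.1
      · simp at h
    | vote | fetch | reply | share => simp [effect, onFetch] at h
  | pbReturn ρ' =>
    simp only [effect] at h ⊢
    split at h <;> simp_all [multicast]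
  | voteZero l' =>
    simp only [effect, multicast, Set.mem_ofPred_eq, Payload.vote.injEq] at h ⊢
    obtain ⟨rfl, rfl⟩ := h
    simp
  | _ => simp [effect, multicast] at h

/-- How an event may change the variables of the ABBA-Invocation of `l`. -/
inductive InstStep (l : Party f) (x : Inst E Proof) : Event E Proof → Inst E Proof → Prop where
  | skip (e) : InstStep l x e x
  | suggestion (j m ρ) (hv : cfg.verify l m ρ) (hx : x.vote = none) :
      InstStep l x (.receive j (.suggestion l m ρ))
        { x with vote := some true, u := true, msg := some (m, ρ) }
  | vote_none (j) : InstStep l x (.receive j (.vote l none))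
      { x with voters := insert j x.voters }
  | vote_some (j m ρ) (hv : cfg.verify l m ρ) : InstStep l x (.receive j (.vote l (some (m, ρ))))
      { x with voters := insert j x.voters, u := true, msg := some (m, ρ) }
  | reply (j m ρ) (hv : cfg.verify l m ρ) (hx : x.msg = none) :
      InstStep l x (.receive j (.reply l m ρ)) { x with msg := some (m, ρ) }
  | receive_share (j σ m ρ) (hm : x.msg = some (m, ρ)) (hv : E.VerifyShare cfg.pk m j σ)
      (hx : x.shares j = none) : InstStep l x (.receive j (.share l σ))
        { x with shares := Function.update x.shares j (some σ) }
  | voteZero : InstStep l x (.voteZero l) { x with vote := some false, u := false, msg := none }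
  | abbaIn (b) : InstStep l x (.abbaIn l b) { x with abbaIn := some b }
  | abbaOut (b) : InstStep l x (.abbaOut l b)
      { x with abbaOut := some b, ret := if b = true then x.ret else some none }
  | fetch : InstStep l x (.fetch l) { x with fetched := true }
  | share (σ) : InstStep l x (.share l σ) { x with shareSent := true }
  | combine (v) : InstStep l x (.combine l v) { x with ret := some (some v) }

theorem instStep_setInst {s : LocalState E Proof} {l l' : Party f} {x : Inst E Proof}
    {e : Event E Proof} (h : cfg.InstStep l (s.inst l) e x) :
    cfg.InstStep l' (s.inst l') e ((s.setInst l x).inst l') := by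
  rw [LocalState.inst_setInst]
  split
  · subst l'; exact h
  · exact .skip e

/-- This replaces the nested case distinctions of `effect` by a short list of transitions, so that
the event responsible for a change of a variable is found by one case analysis. -/
theorem effect_inst (i : Party f) (s : LocalState E Proof) (e : Event E Proof) (l : Party f) :
    cfg.InstStep l (s.inst l) e ((cfg.effect i s e).1.inst l) := by
  cases e with
  | receive j p =>
    cases p with
    | proposal l' m ρ =>
      simp only [effect, onProposal]
      split
      · rw [relay_inst]; exact .skip _
      · exact .skip _
    | suggestion l' m ρ =>
      simp only [effect, onSuggestion]
      split
      · have hr := cfg.relay_inst i { s with suggestFrom := insert j s.suggestFrom } l' m ρ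
        split
        · rename_i hv hx
          have h := cfg.instStep_setInst (l' := l) (s := (cfg.relay i
            { s with suggestFrom := insert j s.suggestFrom } l' m ρ).1) (l := l')
            (e := .receive j (.suggestion l' m ρ))
            (x := { s.inst l' with vote := some true, u := true, msg := some (m, ρ) })
            (by rw [hr]; exact .suggestion j m ρ hv hx)
          rw [hr] at h
          exact h
        · rw [hr]; exact .skip _
      · exact .skip _
    | vote l' msg =>
      rcases msg with _ | ⟨m, ρ⟩ <;> simp only [effect, onVote]
      · exact cfg.instStep_setInst (.vote_none j)
      · split
        · exact cfg.instStep_setInst (.vote_some j m ρ ‹_›)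
        · exact .skip _
    | fetch l' => exact .skip _
    | reply l' m ρ =>
      simp only [effect, onReply]
      split
      · rename_i h
        exact cfg.instStep_setInst (.reply j m ρ h.1 h.2)
      · exact .skip _
    | share l' σ =>
      simp only [effect, onShare]
      split
      · rename_i h
        obtain ⟨⟨m, ρ, hm, hv⟩, hx⟩ := h
        exact cfg.instStep_setInst (.receive_share j σ m ρ hm hv hx)
      · exact .skip _
  | pbReturn ρ =>
    simp only [effect]
    split <;> exact .skip _
  | voteZero l' => exact cfg.instStep_setInst .voteZero
  | abbaIn l' b => exact cfg.instStep_setInst (.abbaIn b)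
  | abbaOut l' b => exact cfg.instStep_setInst (.abbaOut b)
  | fetch l' => exact cfg.instStep_setInst .fetch
  | share l' σ => exact cfg.instStep_setInst (.share σ)
  | combine l' v => exact cfg.instStep_setInst (.combine v)
  | _ => exact .skip _

/-- How an event may change the variables outside the ABBA-Invocations. -/
inductive ShellStep (s : LocalState E Proof) : Event E Proof → LocalState E Proof → Prop where
  | inst (e g) : ShellStep s e { s with inst := g }
  | proposal (j l m ρ b) : ShellStep s (.receive j (.proposal l m ρ)) { s with suggested := b }
  | suggestion (j l m ρ b g) (hv : cfg.verify l m ρ) : ShellStep s (.receive j (.suggestion l m ρ))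
      { s with suggestFrom := insert j s.suggestFrom, suggested := b, inst := g }
  | start : ShellStep s .start { s with started := true }
  | committee (C) : ShellStep s (.committee C) { s with committee := some C }
  | pbInvoke (m) : ShellStep s (.pbInvoke m) { s with pbIn := some m }
  | pbReturn (ρ) : ShellStep s (.pbReturn ρ) { s with pbReturned := true, suggested := true }
  | output (V) : ShellStep s (.output V) { s with output := some V }

theorem exists_relay_eq (i : Party f) (s : LocalState E Proof) (l : Party f) (m : E.Cipher)
    (ρ : Proof) : ∃ b, (cfg.relay i s l m ρ).1 = { s with suggested := b } := by
  unfold relay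
  split
  · exact ⟨_, rfl⟩
  · exact ⟨s.suggested, rfl⟩

theorem effect_shell (i : Party f) (s : LocalState E Proof) (e : Event E Proof) :
    cfg.ShellStep s e (cfg.effect i s e).1 := by
  have skip : ∀ e, cfg.ShellStep s e s := fun e => .inst e s.inst
  cases e with
  | receive j p =>
    cases p with
    | proposal l m ρ =>
      simp only [effect, onProposal]
      split
      · obtain ⟨b, hb⟩ := cfg.exists_relay_eq i s l m ρ
        rw [hb]; exact .proposal ..
      · exact skip _
    | suggestion l m ρ =>
      simp only [effect, onSuggestion]
      split
      · obtain ⟨b, hb⟩ := cfg.exists_relay_eq i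
          { s with suggestFrom := insert j s.suggestFrom } l m ρ
        split
        · rw [hb]; exact .suggestion j l m ρ b _ ‹_›
        · rw [hb]; exact .suggestion j l m ρ b _ ‹_›
      · exact skip _
    | vote l msg =>
      rcases msg with _ | ⟨m, ρ⟩ <;> simp only [effect, onVote]
      · exact .inst ..
      · split
        · exact .inst ..
        · exact skip _
    | fetch l => exact skip _
    | reply l m ρ =>
      simp only [effect, onReply]
      split
      · exact .inst ..
      · exact skip _
    | share l σ =>
      simp only [effect, onShare]
      split
      · exact .inst ..
      · exact skip _
  | pbReturn ρ =>
    simp only [effect]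
    split
    · exact skip _
    · exact .pbReturn ρ
  | pbDeliver => exact skip _
  | start => exact .start
  | committee C => exact .committee C
  | pbInvoke m => exact .pbInvoke m
  | output V => exact .output V
  | _ => exact .inst ..

/-! ### What suggesting and receiving messages achieve. -/

theorem mem_relay_of_suggested {i : Party f} {s : LocalState E Proof} {l : Party f} {m : E.Cipher}
    {ρ : Proof} (h : ¬ s.suggested = true) (h' : (cfg.relay i s l m ρ).1.suggested = true)
    (k : Party f) : (k, .suggestion l m ρ) ∈ (cfg.relay i s l m ρ).2 := by
  unfold relay at h' ⊢
  split at h'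
  · simp_all [multicast]
  · exact absurd h' h

theorem suggestion_mem_effect {i : Party f} {s : LocalState E Proof} {e : Event E Proof}
    (h : ¬ s.suggested = true) (h' : (cfg.effect i s e).1.suggested = true) :
    ∃ l m ρ, ∀ k, (k, .suggestion l m ρ) ∈ (cfg.effect i s e).2 := by
  have hs := cfg.effect_shell i s e
  generalize hs' : (cfg.effect i s e).1 = s' at hs h'
  cases hs with
  | proposal j l m ρ b =>
    refine ⟨l, m, ρ, fun k => ?_⟩
    simp only [effect, onProposal] at hs' ⊢
    split at hs'
    · rename_i hv
      simpa [hv] using cfg.mem_relay_of_suggested h (hs' ▸ h') k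
    · exact absurd ((congrArg LocalState.suggested hs').trans h') h
  | suggestion j l m ρ b g hv =>
    refine ⟨l, m, ρ, fun k => ?_⟩
    have key (hr) := cfg.mem_relay_of_suggested (i := i) (l := l) (m := m) (ρ := ρ)
      (s := { s with suggestFrom := insert j s.suggestFrom }) h hr k
    simp only [effect, onSuggestion, hv, if_true] at hs' ⊢
    split at hs' <;> rename_i hx
    · rw [if_pos hx]
      refine .inl (key ?_)
      exact (congrArg LocalState.suggested hs').trans h'
    · rw [if_neg hx]
      exact key ((congrArg LocalState.suggested hs').trans h')
  | pbReturn ρ =>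
    simp only [effect] at hs' ⊢
    split at hs'
    · exact absurd ((congrArg LocalState.suggested hs').trans h') h
    · exact ⟨i, _, ρ, fun k => .inr rfl⟩
  | _ => exact absurd h' h

theorem vote_effect_suggestion (i j : Party f) (s : LocalState E Proof) {l : Party f} {m : E.Cipher}
    {ρ : Proof} (hv : cfg.verify l m ρ) :
    ((cfg.effect i s (.receive j (.suggestion l m ρ))).1.inst l).vote.isSome = true := by
  simp only [effect, onSuggestion, hv, if_true]
  split
  · simp
  · rw [relay_inst]
    exact Option.isSome_iff_ne_none.mpr ‹_›

/-- A relay is withheld only if a suggestion is already out or the party waits for its own proof.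
The second alternative is resolved later by termination of pPB. -/
theorem suggested_or_proposes (i j : Party f) (s : LocalState E Proof) {l : Party f} {m : E.Cipher}
    {ρ : Proof} (hv : cfg.verify l m ρ) :
    (cfg.effect i s (.receive j (.suggestion l m ρ))).1.suggested = true ∨ cfg.Proposes i s := by
  by_cases hp : cfg.Proposes i s
  · exact .inr hp
  have h : (cfg.relay i { s with suggestFrom := insert j s.suggestFrom } l m ρ).1.suggested =
      true := by
    unfold relay
    split
    · rfl
    · rename_i h
      simpa using fun h' => h ⟨h', hp⟩
  simp only [effect, onSuggestion, hv, if_true]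
  split <;> exact .inl h

theorem mem_suggestFrom_effect (i j : Party f) (s : LocalState E Proof) {l : Party f}
    {m : E.Cipher} {ρ : Proof} (hv : cfg.verify l m ρ) :
    j ∈ (cfg.effect i s (.receive j (.suggestion l m ρ))).1.suggestFrom := by
  obtain ⟨b, hb⟩ := cfg.exists_relay_eq i { s with suggestFrom := insert j s.suggestFrom } l m ρ
  simp only [effect, onSuggestion, hv, if_true]
  split
  · simp [LocalState.setInst, hb]
  · simp [hb]

theorem mem_voters_effect (i j : Party f) (s : LocalState E Proof) {l : Party f}
    {msg : Option (E.Cipher × Proof)} (hv : ∀ m ρ, msg = some (m, ρ) → cfg.verify l m ρ) :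
    j ∈ ((cfg.effect i s (.receive j (.vote l msg))).1.inst l).voters := by
  rcases msg with _ | ⟨m, ρ⟩ <;> simp [effect, onVote]
  simp [hv m ρ rfl]

theorem msg_effect_reply (i j : Party f) (s : LocalState E Proof) {l : Party f} {m : E.Cipher}
    {ρ : Proof} (hv : cfg.verify l m ρ) :
    ((cfg.effect i s (.receive j (.reply l m ρ))).1.inst l).msg.isSome = true := by
  simp only [effect, onReply]
  split
  · simp
  · rename_i h
    exact Option.isSome_iff_ne_none.mpr fun h' => h ⟨hv, h'⟩

theorem shares_effect_share (i j : Party f) (s : LocalState E Proof) {l : Party f} {m : E.Cipher}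
    {ρ : Proof} {σ : E.Share} (hm : (s.inst l).msg = some (m, ρ))
    (hv : E.VerifyShare cfg.pk m j σ) :
    (((cfg.effect i s (.receive j (.share l σ))).1.inst l).shares j).isSome = true := by
  simp only [effect, onShare]
  split
  · simp
  · rename_i h
    exact Option.isSome_iff_ne_none.mpr fun h' => h ⟨⟨m, ρ, hm, hv⟩, h'⟩

end Config

namespace Run

variable {Q : Party f → E.Cipher → Prop} (R : Run E Proof Q)

/-! ## Histories -/

/-- The local state of `i` at time `t`. -/
abbrev loc (i : Party f) (t : ℕ) : LocalState E Proof := (R.state t).loc i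

variable {R} {i j l : Party f} {t t' : ℕ} {e : Event E Proof} {m : E.Cipher} {ρ : Proof}
  {p : Payload E Proof}

theorem honest_of_act (h : R.act t = .honest i e) : R.Honest i := by
  have := R.canStep t
  rw [h] at this
  exact this.1

theorem enabled_of_act (h : R.act t = .honest i e) : R.Enabled i (R.loc i t) e := by
  have := R.canStep t
  rw [h] at this
  exact this.2.1

theorem sent_of_act (h : R.act t = .honest i (.receive j p)) : (j, i, p) ∈ (R.state t).sent := by
  have := R.canStep t
  rw [h] at this
  exact (this.2.2 j p rfl).1

theorem loc_succ (h : R.act t = .honest i e) :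
    R.loc i (t + 1) = (R.effect i (R.loc i t) e).1 := by
  simp [loc, R.step, h, Config.next]

theorem loc_succ_of_ne (h : ∀ e, R.act t ≠ .honest i e) : R.loc i (t + 1) = R.loc i t := by
  simp only [loc, R.step]
  cases ha : R.act t with
  | honest k e =>
    have : i ≠ k := by rintro rfl; exact h _ ha
    simp [Config.next, this]
  | _ => simp [Config.next]

theorem loc_zero : R.loc i 0 = {} := by
  simp [loc, R.init]

variable (R) in
theorem inv (i : Party f) (t : ℕ) : (R.loc i t).Inv R.toConfig i := by
  induction t with
  | zero =>
    rw [loc_zero]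
    constructor <;> simp
    constructor <;> simp
  | succ t ih =>
    by_cases h : ∃ e, R.act t = .honest i e
    · obtain ⟨e, h⟩ := h
      rw [loc_succ h]
      exact R.inv_effect ih (enabled_of_act h)
    · rwa [loc_succ_of_ne (by simpa using h)]

theorem loc_le_succ : (R.loc i t).Le (R.loc i (t + 1)) := by
  by_cases h : ∃ e, R.act t = .honest i e
  · obtain ⟨e, h⟩ := h
    rw [loc_succ h]
    exact R.le_effect (R.inv i t) (enabled_of_act h)
  · rw [loc_succ_of_ne (by simpa using h)]
    exact .refl _

theorem loc_le (h : t ≤ t') : (R.loc i t).Le (R.loc i t') := by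
  induction t', h using Nat.le_induction with
  | base => exact .refl _
  | succ t' _ ih => exact ih.trans loc_le_succ

/-- A property of the local state that does not hold at first is brought about by some event. -/
theorem exists_act_of_change {P : LocalState E Proof → Prop} (h0 : ¬ P {}) (ht : P (R.loc i t)) :
    ∃ t' < t, ∃ e, R.act t' = .honest i e ∧ R.Enabled i (R.loc i t') e ∧ ¬ P (R.loc i t') ∧
      P (R.effect i (R.loc i t') e).1 := by
  induction t with
  | zero => rw [loc_zero] at ht; exact absurd ht h0
  | succ t ih =>
    by_cases hP : P (R.loc i t)
    · obtain ⟨t', h, h'⟩ := ih hP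
      exact ⟨t', by omega, h'⟩
    · by_cases h : ∃ e, R.act t = .honest i e
      · obtain ⟨e, h⟩ := h
        rw [loc_succ h] at ht
        exact ⟨t, by omega, e, h, enabled_of_act h, hP, ht⟩
      · rw [loc_succ_of_ne (by simpa using h)] at ht
        exact absurd ht hP

theorem sent_mono (h : t ≤ t') : (R.state t).sent ⊆ (R.state t').sent := by
  induction t', h using Nat.le_induction with
  | base => exact subset_rfl
  | succ t' _ ih =>
    refine ih.trans ?_
    rw [R.step]
    cases R.act t' with
    | honest i e => exact Set.subset_union_left
    | inject j i p => exact Set.subset_insert _ _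
    | idle => exact subset_rfl

theorem sent_succ (h : R.act t = .honest j e) (hp : (i, p) ∈ (R.effect j (R.loc j t) e).2) :
    (j, i, p) ∈ (R.state (t + 1)).sent := by
  rw [R.step, h]
  exact .inr ⟨rfl, hp⟩

/-- This is authentication: injected packets bear the name of a faulty sender. -/
theorem exists_act_of_sent (hj : R.Honest j) (h : (j, i, p) ∈ (R.state t).sent) :
    ∃ t' < t, ∃ e, R.act t' = .honest j e ∧ (i, p) ∈ (R.effect j (R.loc j t') e).2 := by
  induction t with
  | zero => simp [R.init] at h
  | succ t ih =>
    by_cases h' : (j, i, p) ∈ (R.state t).sent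
    · obtain ⟨t', h, h'⟩ := ih h'
      exact ⟨t', by omega, h'⟩
    rw [R.step] at h
    cases ha : R.act t with
    | honest k e =>
      rw [ha] at h
      rcases h with h | ⟨rfl, h⟩
      · exact absurd h h'
      · exact ⟨t, by omega, e, ha, h⟩
    | inject k k' p' =>
      have hc := R.canStep t
      rw [ha] at h hc
      rcases h with h | h
      · cases h
        exact absurd hc hj
      · exact absurd h h'
    | idle =>
      rw [ha] at h
      exact absurd h h'

theorem sent_all (hj : R.Honest j) (h : (j, i, p) ∈ (R.state t).sent)
    (hp : ∀ l m ρ, p ≠ .reply l m ρ) (k : Party f) : (j, k, p) ∈ (R.state t).sent := by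
  obtain ⟨t', ht, e, he, h'⟩ := exists_act_of_sent hj h
  exact sent_mono ht (sent_succ he (R.mem_effect_all h' hp k))

theorem rcvd_mono (h : t ≤ t') : (R.state t).rcvd ⊆ (R.state t').rcvd := by
  induction t', h using Nat.le_induction with
  | base => exact subset_rfl
  | succ t' _ ih =>
    refine ih.trans ?_
    rw [R.step]
    cases R.act t' with
    | honest i e => exact Set.subset_union_left
    | inject j i p => exact subset_rfl
    | idle => exact subset_rfl

theorem occurs_of_rcvd (h : (j, i, p) ∈ (R.state t).rcvd) : R.Occurs i (.receive j p) := by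
  induction t with
  | zero => simp [R.init] at h
  | succ t ih =>
    rw [R.step] at h
    cases ha : R.act t with
    | honest k e =>
      rw [ha] at h
      rcases h with h | ⟨rfl, rfl⟩
      · exact ih h
      · exact ⟨t, ha⟩
    | _ =>
      rw [ha] at h
      exact ih h

theorem produced_of_receive (h : R.act t = .honest i (.receive j p)) (hp : p.Carries l m ρ)
    (hv : R.verify l m ρ) : R.Produced l m ρ :=
  ⟨hv, t, j, i, p, sent_of_act h, hp⟩

/-! ### What the local variables say about the past -/

theorem occurs_committee {C : Finset (Party f)} (h : (R.loc i t).committee = some C) :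
    R.Occurs i (.committee C) := by
  obtain ⟨t', -, e, he, en, hn, hp⟩ :=
    exists_act_of_change (P := fun s => s.committee = some C) (by simp) h
  suffices e = .committee C from ⟨t', this ▸ he⟩
  have hs := R.effect_shell i (R.loc i t') e
  generalize (R.effect i (R.loc i t') e).1 = s' at hs hp
  cases hs <;> simp_all

theorem occurs_pbInvoke (h : (R.loc i t).pbIn = some m) : R.Occurs i (.pbInvoke m) := by
  obtain ⟨t', -, e, he, en, hn, hp⟩ :=
    exists_act_of_change (P := fun s => s.pbIn = some m) (by simp) h
  suffices e = .pbInvoke m from ⟨t', this ▸ he⟩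
  have hs := R.effect_shell i (R.loc i t') e
  generalize (R.effect i (R.loc i t') e).1 = s' at hs hp
  cases hs <;> simp_all

theorem occurs_output {V : Finset E.Plain} (h : (R.loc i t).output = some V) :
    R.Occurs i (.output V) := by
  obtain ⟨t', -, e, he, en, hn, hp⟩ :=
    exists_act_of_change (P := fun s => s.output = some V) (by simp) h
  suffices e = .output V from ⟨t', this ▸ he⟩
  have hs := R.effect_shell i (R.loc i t') e
  generalize (R.effect i (R.loc i t') e).1 = s' at hs hp
  cases hs <;> simp_all

theorem occurs_start (h : (R.loc i t).started = true) : R.Occurs i .start := by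
  obtain ⟨t', -, e, he, en, hn, hp⟩ :=
    exists_act_of_change (P := fun s => s.started = true) (by simp) h
  suffices e = .start from ⟨t', this ▸ he⟩
  have hs := R.effect_shell i (R.loc i t') e
  generalize (R.effect i (R.loc i t') e).1 = s' at hs hp
  cases hs <;> simp_all

theorem sent_suggestion_of_suggested (h : (R.loc i t).suggested = true) :
    ∃ l m ρ, ∀ k, (i, k, .suggestion l m ρ) ∈ (R.state t).sent := by
  obtain ⟨t', ht, e, he, en, hn, hp⟩ :=
    exists_act_of_change (P := fun s => s.suggested = true) (by simp) h
  obtain ⟨l, m, ρ, h⟩ := R.suggestion_mem_effect hn hp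
  exact ⟨l, m, ρ, fun k => sent_mono ht (sent_succ he (h k))⟩

/-- Counting a suggestion and voting for its proposal are one atomic step, so whenever `j` is
counted a vote on its proposal has been cast. That vote may still be an earlier `0`;
`exists_quorum_voted` excludes this by its choice of time. -/
theorem sent_of_mem_suggestFrom (h : j ∈ (R.loc i t).suggestFrom) :
    ∃ l m ρ, R.verify l m ρ ∧ (j, i, .suggestion l m ρ) ∈ (R.state t).sent ∧
      ((R.loc i t).inst l).vote.isSome = true := by
  obtain ⟨t', ht, e, he, en, hn, hp⟩ :=
    exists_act_of_change (P := fun s => j ∈ s.suggestFrom) (by simp) h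
  have : ∃ l m ρ, e = .receive j (.suggestion l m ρ) ∧ R.verify l m ρ := by
    have hs := R.effect_shell i (R.loc i t') e
    generalize (R.effect i (R.loc i t') e).1 = s' at hs hp
    cases hs <;> simp_all
  obtain ⟨l, m, ρ, rfl, hv⟩ := this
  refine ⟨l, m, ρ, hv, sent_mono ht.le (sent_of_act he), ?_⟩
  have hvote := R.vote_effect_suggestion i j (R.loc i t') hv
  rw [← loc_succ he] at hvote
  obtain ⟨b, hb⟩ := Option.isSome_iff_exists.mp hvote
  exact Option.isSome_iff_exists.mpr ⟨b, ((loc_le ht).inst l).vote b hb⟩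

/-- The new value is a separate variable `y`, so that a case analysis of the transition can unify it
with each possible outcome. -/
theorem exists_instStep_of_change {P : Inst E Proof → Prop} (h0 : ¬ P {})
    (ht : P ((R.loc i t).inst l)) :
    ∃ t' < t, ∃ e y, R.act t' = .honest i e ∧ R.Enabled i (R.loc i t') e ∧
      (R.loc i (t' + 1)).inst l = y ∧ R.InstStep l ((R.loc i t').inst l) e y ∧
      ¬ P ((R.loc i t').inst l) ∧ P y := by
  obtain ⟨t', ht, e, he, en, hn, hp⟩ :=
    exists_act_of_change (P := fun s => P (s.inst l)) h0 ht
  exact ⟨t', ht, e, _, he, en, by rw [loc_succ he], R.effect_inst i _ e l, hn, hp⟩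

theorem occurs_abbaIn {b : Bool} (h : ((R.loc i t).inst l).abbaIn = some b) :
    R.Occurs i (.abbaIn l b) := by
  obtain ⟨t', -, e, y, he, en, -, hs, hn, hp⟩ :=
    exists_instStep_of_change (P := fun x => x.abbaIn = some b) (by simp) h
  suffices e = .abbaIn l b from ⟨t', this ▸ he⟩
  cases hs <;> simp_all

theorem occurs_abbaOut {b : Bool} (h : ((R.loc i t).inst l).abbaOut = some b) :
    R.Occurs i (.abbaOut l b) := by
  obtain ⟨t', -, e, y, he, en, -, hs, hn, hp⟩ :=
    exists_instStep_of_change (P := fun x => x.abbaOut = some b) (by simp) h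
  suffices e = .abbaOut l b from ⟨t', this ▸ he⟩
  cases hs <;> simp_all

theorem sent_vote_of_vote {b : Bool} (h : ((R.loc i t).inst l).vote = some b) :
    ∃ msg, ∀ k, (i, k, .vote l msg) ∈ (R.state t).sent := by
  obtain ⟨t', ht, e, y, he, en, -, hs, hn, hp⟩ :=
    exists_instStep_of_change (P := fun x => x.vote = some b) (by simp) h
  suffices ∃ msg, ∀ k, (k, .vote l msg) ∈ (R.effect i (R.loc i t') e).2 by
    obtain ⟨msg, h⟩ := this
    exact ⟨msg, fun k => sent_mono ht (sent_succ he (h k))⟩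
  cases hs with
  | suggestion j m ρ hv hvote =>
    refine ⟨some (m, ρ), fun k => ?_⟩
    simp [Config.effect, Config.onSuggestion, hv, hvote, multicast]
  | voteZero => exact ⟨none, fun k => by simp [Config.effect, multicast]⟩
  | _ => simp_all

theorem suggestFrom_card_of_vote (h : ((R.loc i t).inst l).vote = some false) :
    ∃ t' < t, 2 * f + 1 ≤ (R.loc i t').suggestFrom.card ∧ ((R.loc i t').inst l).vote = none := by
  obtain ⟨t', ht, e, y, he, en, -, hs, hn, hp⟩ :=
    exists_instStep_of_change (P := fun x => x.vote = some false) (by simp) h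
  suffices e = .voteZero l by subst this; exact ⟨t', ht, en.2⟩
  cases hs <;> simp_all

theorem voters_card_of_abbaIn {b : Bool} (h : ((R.loc i t).inst l).abbaIn = some b) :
    ∃ t' < t, 2 * f + 1 ≤ ((R.loc i t').inst l).voters.card ∧ b = ((R.loc i t').inst l).u := by
  obtain ⟨t', ht, e, y, he, en, -, hs, hn, hp⟩ :=
    exists_instStep_of_change (P := fun x => x.abbaIn = some b) (by simp) h
  suffices e = .abbaIn l b by subst this; exact ⟨t', ht, en.2.1, en.2.2.2⟩
  cases hs <;> simp_all

theorem produced_of_msg (h : ((R.loc i t).inst l).msg = some (m, ρ)) : R.Produced l m ρ := by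
  obtain ⟨t', ht, e, y, he, en, -, hs, hn, hp⟩ :=
    exists_instStep_of_change (P := fun x => x.msg = some (m, ρ)) (by simp) h
  suffices ∃ j p, e = .receive j p ∧ p.Carries l m ρ ∧ R.verify l m ρ by
    obtain ⟨j, p, rfl, hp, hv⟩ := this
    exact produced_of_receive he hp hv
  cases hs <;> simp_all [Payload.Carries]

theorem sent_of_mem_voters (h : j ∈ ((R.loc i t).inst l).voters) :
    ∃ msg, (j, i, .vote l msg) ∈ (R.state t).sent ∧
      (msg.isSome = true → ((R.loc i t).inst l).u = true) := by
  obtain ⟨t', ht, e, y, he, en, rfl, hs, hn, hp⟩ :=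
    exists_instStep_of_change (P := fun x => j ∈ x.voters) (by simp) h
  suffices ∃ msg, e = .receive j (.vote l msg) ∧
      (msg.isSome = true → ((R.loc i (t' + 1)).inst l).u = true) by
    obtain ⟨msg, rfl, hu⟩ := this
    exact ⟨msg, sent_mono ht.le (sent_of_act he), fun h => ((loc_le ht).inst l).u (hu h)⟩
  generalize (R.loc i (t' + 1)).inst l = y at hs hp
  cases hs <;> simp_all

/-- The share was checked against the proposal stored at its reception, which may have been replaced
since; provability identifies the two ciphertexts later. -/
theorem verifyShare_of_shares {σ : E.Share} (h : ((R.loc i t).inst l).shares j = some σ) :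
    ∃ m ρ, R.Produced l m ρ ∧ E.VerifyShare R.pk m j σ := by
  obtain ⟨t', ht, e, y, he, en, -, hs, hn, hp⟩ :=
    exists_instStep_of_change (P := fun x => x.shares j = some σ) (by simp) h
  suffices ∃ m ρ, ((R.loc i t').inst l).msg = some (m, ρ) ∧ E.VerifyShare R.pk m j σ by
    obtain ⟨m, ρ, hm, hv⟩ := this
    exact ⟨m, ρ, produced_of_msg hm, hv⟩
  cases hs <;> simp_all [Function.update_apply]
  grind

theorem sent_fetch_of_fetched (h : ((R.loc i t).inst l).fetched = true) (k : Party f) :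
    (i, k, .fetch l) ∈ (R.state t).sent := by
  obtain ⟨t', ht, e, y, he, en, -, hs, hn, hp⟩ :=
    exists_instStep_of_change (P := fun x => x.fetched = true) (by simp) h
  have : e = .fetch l := by cases hs <;> simp_all
  subst this
  exact sent_mono ht (sent_succ he rfl)

theorem sent_share_of_shareSent (h : ((R.loc i t).inst l).shareSent = true) :
    ∃ m ρ σ, R.Produced l m ρ ∧ E.decShare (R.sk i) m = some σ ∧
      ∀ k, (i, k, .share l σ) ∈ (R.state t).sent := by
  obtain ⟨t', ht, e, y, he, en, -, hs, hn, hp⟩ :=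
    exists_instStep_of_change (P := fun x => x.shareSent = true) (by simp) h
  have : ∃ σ, e = .share l σ := by cases hs <;> simp_all
  obtain ⟨σ, rfl⟩ := this
  obtain ⟨-, -, m, ρ, hm, hσ⟩ := en
  exact ⟨m, ρ, σ, produced_of_msg hm, hσ, fun k => sent_mono ht (sent_succ he rfl)⟩

theorem enabled_combine_of_ret {v : E.Plain} (h : ((R.loc i t).inst l).ret = some (some v)) :
    ∃ t', R.Enabled i (R.loc i t') (.combine l v) := by
  obtain ⟨t', ht, e, y, he, en, -, hs, hn, hp⟩ :=
    exists_instStep_of_change (P := fun x => x.ret = some (some v)) (by simp) h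
  suffices e = .combine l v from ⟨t', this ▸ en⟩
  cases hs <;> simp_all
  -- An ABBA output either keeps `ret` or sets it to `some none`, so it cannot create a value.
  split at hp <;> simp_all

end Run

namespace Run

open Filter

variable {Q : Party f → E.Cipher → Prop} {R : Run E Proof Q}
variable {i j k l : Party f} {t t' : ℕ} {e : Event E Proof} {m m' : E.Cipher} {ρ ρ' : Proof}
  {p : Payload E Proof} {C : Finset (Party f)}

/-! ## Counting honest parties -/

variable (R) in
theorem card_compl_faulty : 2 * f + 1 ≤ R.faultyᶜ.card := by
  rw [Finset.card_compl, Fintype.card_fin]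
  have := R.faulty_card
  omega

theorem mem_compl_faulty : i ∈ R.faultyᶜ ↔ R.Honest i := Finset.mem_compl

theorem card_le_honestCount (S : Finset (Party f))
    (h : ∀ i ∈ S, R.Honest i ∧ R.Occurs i e) : S.card ≤ R.honestCount e := by
  classical
  exact Finset.card_le_card fun i hi => by simpa using h i hi

theorem exists_honest_of_honestCount (h : f + 1 ≤ R.honestCount e) :
    ∃ i, R.Honest i ∧ R.Occurs i e := by
  classical
  obtain ⟨i, hi⟩ := Finset.card_pos.mp (Nat.lt_of_lt_of_le (Nat.succ_pos f) h)
  exact ⟨i, by simpa using hi⟩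

theorem exists_honest_of_card {S : Finset (Party f)} (h : f + 1 ≤ S.card) :
    ∃ i ∈ S, R.Honest i := by
  by_contra! h'
  have : S.card ≤ R.faulty.card :=
    Finset.card_le_card fun i hi => by simpa [Honest] using h' i hi
  have := R.faulty_card
  omega

/-! ## Fairness -/

/-- If `P` never held, `e` would stay enabled from some time on, so fairness would make it occur and
bring about `P`. -/
theorem eventually_of_fair {P : ℕ → Prop} (hi : R.Honest i) (he : R.Obligatory e)
    (mono : ∀ t, P t → P (t + 1))
    (en : ∀ᶠ t in atTop, ¬ P t → R.CanStep (R.state t) (.honest i e))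
    (eff : ∀ t, R.act t = .honest i e → P (t + 1)) : ∀ᶠ t in atTop, P t := by
  suffices ∃ t, P t by
    obtain ⟨t, ht⟩ := this
    filter_upwards [eventually_ge_atTop t] with t' h
    induction t', h using Nat.le_induction with
    | base => exact ht
    | succ t' _ ih => exact mono _ ih
  by_contra! h
  obtain ⟨t, ht⟩ := eventually_atTop.mp en
  obtain ⟨t', -, hact⟩ := R.fair i e t hi he fun t' h' => ht t' h' (h t')
  exact h _ (eff t' hact)

/-- An internal event of an honest party that stays enabled until `P` holds, and brings about `P`,
makes `P` hold. -/
theorem eventually_loc_of_fair {P : LocalState E Proof → Prop} (hi : R.Honest i)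
    (he : R.Obligatory e) (he' : ∀ j p, e ≠ .receive j p)
    (mono : ∀ s s', LocalState.Le s s' → P s → P s')
    (en : ∀ᶠ t in atTop, ¬ P (R.loc i t) → R.Enabled i (R.loc i t) e)
    (eff : ∀ s, R.Enabled i s e → P (R.effect i s e).1) : ∀ᶠ t in atTop, P (R.loc i t) := by
  refine eventually_of_fair hi he (fun t => mono _ _ loc_le_succ)
    (en.mono fun t h hP => ⟨hi, h hP, fun j p h' => absurd h' (he' j p)⟩) fun t ht => ?_
  rw [loc_succ ht]
  exact eff _ (enabled_of_act ht)

theorem eventually_le (i : Party f) (t : ℕ) : ∀ᶠ t' in atTop, (R.loc i t).Le (R.loc i t') := by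
  filter_upwards [eventually_ge_atTop t] with t' h using loc_le h

/-- Messages between honest parties are received. -/
theorem occurs_receive (hi : R.Honest i) (hj : R.Honest j) (hs : (j, i, p) ∈ (R.state t).sent)
    (hr : ∀ᶠ t in atTop, Config.Ready (R.loc i t) p) : R.Occurs i (.receive j p) := by
  have h : ∀ᶠ t in atTop, (j, i, p) ∈ (R.state t).rcvd := by
    refine eventually_of_fair (e := .receive j p) hi hj (fun t h => rcvd_mono (Nat.le_succ t) h)
      ?_ fun t ht => ?_
    · filter_upwards [hr, eventually_ge_atTop t] with t' hr ht hn
      refine ⟨hi, hr, fun j' p' h => ?_⟩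
      cases h
      exact ⟨sent_mono ht hs, hn⟩
    · rw [R.step, ht]
      exact .inr ⟨rfl, rfl⟩
  obtain ⟨t, ht⟩ := h.exists
  exact occurs_of_rcvd ht

/-! ## The committee -/

variable (R) in
/-- The sub-protocols have their properties in the execution `R`. -/
structure Secure : Prop where
  cs : R.CommitteeSecure
  pb : ∀ l, R.PBSecure l
  abba : ∀ l, R.ABBASecure l

variable (R) in
/-- All honest parties obtain the committee `C`. -/
def IsCommittee (C : Finset (Party f)) : Prop :=
  ∀ i, R.Honest i → ∀ᶠ t in atTop, (R.loc i t).committee = some C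

theorem eventually_started (hi : R.Honest i) : ∀ᶠ t in atTop, (R.loc i t).started = true :=
  eventually_loc_of_fair (e := .start) (P := fun s => s.started = true) hi trivial (by simp)
    (fun _ _ h => h.started) (.of_forall fun t h => by simpa [Config.Enabled] using h)
    fun _ _ => rfl

theorem eventually_committee (h : R.Occurs i (.committee C)) :
    ∀ᶠ t in atTop, (R.loc i t).committee = some C := by
  obtain ⟨t, ht⟩ := h
  filter_upwards [eventually_le i (t + 1)] with t' h
  exact h.committee C (by rw [loc_succ ht]; rfl)

theorem Secure.exists_committee (hS : R.Secure) : ∃ C, R.IsCommittee C := by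
  have hs : ∀ i, R.Honest i → R.Occurs i .start := fun i hi =>
    occurs_start (eventually_started hi).exists.choose_spec
  have hc : f + 1 ≤ R.honestCount .start := by
    have := card_le_honestCount R.faultyᶜ fun i hi =>
      ⟨mem_compl_faulty.mp hi, hs i (mem_compl_faulty.mp hi)⟩
    have := R.card_compl_faulty
    omega
  have key := fun i hi => hS.cs.termination hc i hi (hs i hi)
  obtain ⟨i₀, hi₀, -⟩ := exists_honest_of_honestCount hc
  obtain ⟨C, hC⟩ := key i₀ hi₀
  refine ⟨C, fun i hi => ?_⟩
  obtain ⟨C', hC'⟩ := key i hi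
  obtain rfl := hS.cs.agreement i i₀ C' C hi hi₀ hC' hC
  exact eventually_committee hC'

theorem IsCommittee.eq (hC : R.IsCommittee C) (hi : R.Honest i) {C' : Finset (Party f)}
    (h : (R.loc i t).committee = some C') : C' = C := by
  obtain ⟨t', h₁, h₂⟩ := ((hC i hi).and (eventually_le i t)).exists
  exact Option.some_injective _ ((h₂.committee C' h).symm.trans h₁)

theorem IsCommittee.eq_of_occurs (hC : R.IsCommittee C) (hi : R.Honest i) {C' : Finset (Party f)}
    (h : R.Occurs i (.committee C')) : C' = C := by
  obtain ⟨t, ht⟩ := (eventually_committee h).exists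
  exact hC.eq hi ht

theorem IsCommittee.occurs (hC : R.IsCommittee C) (hi : R.Honest i) :
    R.Occurs i (.committee C) :=
  occurs_committee (hC i hi).exists.choose_spec

/-! ## Messages with a valid proof -/

/-- Provability, applied to a proof paired with itself, turns a proof sent by anybody into
deliveries at honest parties, to which validity and selectedness of pPB apply. -/
theorem Secure.deliver_of_produced (hS : R.Secure) (h : R.Produced l m ρ) :
    ∃ i, R.Honest i ∧ R.Occurs i (.pbDeliver l m) :=
  exists_honest_of_honestCount ((hS.pb l).provability m m ρ ρ h h).2

theorem Secure.mem_of_produced (hS : R.Secure) (hC : R.IsCommittee C) (h : R.Produced l m ρ) :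
    l ∈ C := by
  obtain ⟨i, hi, hd⟩ := hS.deliver_of_produced h
  obtain ⟨⟨C', hC', hl⟩, -⟩ := (hS.pb l).selected i m hi hd
  rwa [hC.eq_of_occurs hi hC'] at hl

theorem Secure.valid_of_produced (hS : R.Secure) (h : R.Produced l m ρ) :
    R.ExternallyValid Q l m := by
  obtain ⟨i, hi, hd⟩ := hS.deliver_of_produced h
  exact (hS.pb l).validity i m hi hd

theorem Secure.input_of_produced (hS : R.Secure) (h : R.Produced l m ρ) (hl : R.Honest l) :
    ∃ v, R.input l = some v ∧ m = E.enc R.pk v (R.coins l) := by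
  obtain ⟨i, hi, hd⟩ := hS.deliver_of_produced h
  obtain ⟨t, ht⟩ := ((hS.pb l).selected i m hi hd).2 hl
  exact (enabled_of_act ht).2.2

theorem Secure.produced_unique (hS : R.Secure) (hm : R.Produced l m ρ) (hm' : R.Produced l m' ρ') :
    m = m' :=
  ((hS.pb l).provability m m' ρ ρ' hm hm').1

/-- The decryption shares of all parties. -/
def allShares (R : Run E Proof Q) (m : E.Cipher) : Party f → Option E.Share :=
  fun j => E.decShare (R.sk j) m

theorem validShares_allShares (hE : E.Correct) (hm : E.WellFormed R.pk m) :
    E.ValidShares R.pk m (R.allShares m) := by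
  refine ⟨?_, fun j σ h => hE.decShare_verify _ _ m j σ R.keys h⟩
  have : ∀ j, (R.allShares m j).isSome = true := fun j =>
    (hE.decShare_isSome _ _ m j R.keys).mpr hm
  simp [this]
  omega

/-- All stored shares are valid for the same ciphertext by provability. Comparison with the family
of all key holders' shares makes the plaintext independent of the party and of the time. -/
theorem Secure.dec_eq (hS : R.Secure) (hE : E.Correct) (h : R.Produced l m ρ)
    (hc : f + 1 ≤ (Finset.univ.filter fun j =>
      (((R.loc i t).inst l).shares j).isSome = true).card) :
    E.dec R.pk m ((R.loc i t).inst l).shares = E.dec R.pk m (R.allShares m) := by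
  refine hE.dec_unique _ _ _ _ _ R.keys ⟨hc, fun j σ hσ => ?_⟩
    (validShares_allShares hE (hS.valid_of_produced h).1)
  obtain ⟨m', ρ', h', hv⟩ := verifyShare_of_shares hσ
  rwa [hS.produced_unique h h']

theorem Secure.exists_dec_of_ret (hS : R.Secure) (hE : E.Correct) {v : E.Plain}
    (h : ((R.loc i t).inst l).ret = some (some v)) :
    ∃ m ρ, R.Produced l m ρ ∧ E.dec R.pk m (R.allShares m) = some v := by
  obtain ⟨t', -, -, hc, m, ρ, hm, hv⟩ := enabled_combine_of_ret h
  have hp := produced_of_msg hm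
  exact ⟨m, ρ, hp, by rw [← hv, hS.dec_eq hE hp hc]⟩

theorem Secure.ret_unique (hS : R.Secure) (hE : E.Correct) (hi : R.Honest i) (hj : R.Honest j)
    {r r' : Option E.Plain} (h : ((R.loc i t).inst l).ret = some r)
    (h' : ((R.loc j t').inst l).ret = some r') : r = r' := by
  have hb := (hS.abba l).agreement i j _ _ hi hj
    (occurs_abbaOut (((R.inv i t).inst l).abbaOut_of_ret r h))
    (occurs_abbaOut (((R.inv j t').inst l).abbaOut_of_ret r' h'))
  rcases r with _ | v <;> rcases r' with _ | v' <;> simp at hb ⊢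
  obtain ⟨m, ρ, hm, hv⟩ := hS.exists_dec_of_ret hE h
  obtain ⟨m', ρ', hm', hv'⟩ := hS.exists_dec_of_ret hE h'
  obtain rfl := hS.produced_unique hm hm'
  exact Option.some_injective _ (hv.symm.trans hv')

/-! ## Suggestions -/

/-- Termination of pPB only promises that some returned proof is valid. Since a call returns at most
once, that proof is `ρ`. -/
theorem Secure.verify_of_pbReturn (hS : R.Secure) (ht : R.act t = .honest i (.pbReturn ρ))
    (hm : (R.loc i t).pbIn = some m) : R.verify i m ρ := by
  have hi := honest_of_act ht
  obtain ⟨t₀, h₀⟩ := occurs_pbInvoke hm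
  obtain ⟨-, -, v, hv, rfl⟩ := enabled_of_act h₀
  obtain ⟨-, ρ', ⟨t', ht'⟩, hρ⟩ :=
    (hS.pb i).termination _ hi ⟨t₀, h₀⟩ (R.input_valid i v hi hv)
  have once : ∀ t t' ρ ρ', R.act t = .honest i (.pbReturn ρ) →
      R.act t' = .honest i (.pbReturn ρ') → ¬ t < t' := by
    intro t t' ρ ρ' ht ht' hlt
    have en := enabled_of_act ht
    have en' := enabled_of_act ht'
    obtain ⟨m', hm'⟩ := Option.isSome_iff_exists.mp en.1
    have := (loc_le (i := i) (R := R) hlt).pbReturned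
      (by rw [loc_succ ht]; simp [Config.effect, hm'])
    rw [en'.2] at this
    exact Bool.false_ne_true this
  have : t = t' := by
    have := once _ _ _ _ ht ht'
    have := once _ _ _ _ ht' ht
    omega
  subst this
  rw [ht] at ht'
  cases ht'
  exact hρ

theorem Secure.verify_of_sent (hS : R.Secure) (hi : R.Honest i)
    (h : (i, k, .suggestion l m ρ) ∈ (R.state t).sent) : R.verify l m ρ := by
  obtain ⟨t', -, e, he, hp⟩ := exists_act_of_sent hi h
  rcases (R.mem_effect_suggestion hp).2 with ⟨rfl, rfl, hm⟩ | h
  · exact hS.verify_of_pbReturn he hm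
  · exact h.1

variable (R) in
/-- `i` multicasts a suggestion with a valid proof. -/
def Suggests (i : Party f) : Prop :=
  ∃ l m ρ, R.verify l m ρ ∧ ∃ t, ∀ k, (i, k, .suggestion l m ρ) ∈ (R.state t).sent

theorem Secure.suggests_of_suggested (hS : R.Secure) (hi : R.Honest i)
    (h : (R.loc i t).suggested = true) : R.Suggests i := by
  obtain ⟨l, m, ρ, h⟩ := sent_suggestion_of_suggested h
  exact ⟨l, m, ρ, hS.verify_of_sent hi (h i), t, h⟩

theorem Secure.suggests_of_proposes (hS : R.Secure) (hi : R.Honest i)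
    (h : R.Proposes i (R.loc i t)) : R.Suggests i := by
  obtain ⟨⟨C, hC, hiC⟩, hv⟩ := h
  obtain ⟨v, hv⟩ := Option.isSome_iff_exists.mp hv
  have h : ∀ᶠ t in atTop, (R.loc i t).pbIn.isSome = true := by
    refine eventually_loc_of_fair (e := .pbInvoke (E.enc R.pk v (R.coins i)))
      (P := fun s => s.pbIn.isSome = true) hi trivial (by simp) (fun s s' h hs => ?_) ?_
      fun _ _ => rfl
    · obtain ⟨m, hm⟩ := Option.isSome_iff_exists.mp hs
      exact Option.isSome_iff_exists.mpr ⟨m, h.pbIn m hm⟩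
    · filter_upwards [eventually_le i t] with t' h hn
      exact ⟨by simpa using hn, ⟨C, h.committee C hC, hiC⟩, v, hv, rfl⟩
  obtain ⟨t', ht'⟩ := h.exists
  obtain ⟨m, hm⟩ := Option.isSome_iff_exists.mp ht'
  have hinv := occurs_pbInvoke hm
  have hval : R.ExternallyValid Q i m := by
    obtain ⟨t₀, h₀⟩ := hinv
    obtain ⟨-, -, v, hv, rfl⟩ := enabled_of_act h₀
    exact R.input_valid i v hi hv
  obtain ⟨-, ρ, ⟨t₁, h₁⟩, -⟩ := (hS.pb i).termination m hi hinv hval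
  have en := enabled_of_act h₁
  obtain ⟨m', hm'⟩ := Option.isSome_iff_exists.mp en.1
  exact hS.suggests_of_suggested hi (t := t₁ + 1) (by rw [loc_succ h₁]; simp [Config.effect, hm'])

theorem IsCommittee.receive_suggestion (hC : R.IsCommittee C) (hi : R.Honest i) (hj : R.Honest j)
    (h : (j, i, .suggestion l m ρ) ∈ (R.state t).sent) :
    R.Occurs i (.receive j (.suggestion l m ρ)) :=
  occurs_receive hi hj h ((hC i hi).mono fun t h => by simp [Config.Ready, h])

theorem Secure.suggests_of_suggests (hS : R.Secure) (hC : R.IsCommittee C) (hj : R.Honest j)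
    (h : R.Suggests j) (hi : R.Honest i) : R.Suggests i := by
  obtain ⟨l, m, ρ, hv, t, h⟩ := h
  obtain ⟨t', ht'⟩ := hC.receive_suggestion hi hj (h i)
  rcases R.suggested_or_proposes i j (R.loc i t') hv with h | h
  · exact hS.suggests_of_suggested hi (t := t' + 1) (by rwa [loc_succ ht'])
  · exact hS.suggests_of_proposes hi h

/-- All honest parties suggest as soon as one has counted `2f + 1` suggestions. -/
theorem Secure.suggests_of_card (hS : R.Secure) (hC : R.IsCommittee C)
    (h : 2 * f + 1 ≤ (R.loc i t).suggestFrom.card) (hj : R.Honest j) : R.Suggests j := by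
  obtain ⟨k, hk, hkh⟩ := exists_honest_of_card (R := R) (S := (R.loc i t).suggestFrom) (by omega)
  obtain ⟨l, m, ρ, hv, hs, -⟩ := sent_of_mem_suggestFrom hk
  exact hS.suggests_of_suggests hC hkh ⟨l, m, ρ, hv, t, sent_all hkh hs (by simp)⟩ hj

/-- A wait for `2f + 1` parties cannot block, because the honest ones suffice. -/
theorem card_le_of_forall_honest {S : Finset (Party f)} (h : ∀ j, R.Honest j → j ∈ S) :
    2 * f + 1 ≤ S.card :=
  R.card_compl_faulty.trans (Finset.card_le_card fun j hj => h j (mem_compl_faulty.mp hj))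

theorem eventually_forall_honest {P : Party f → ℕ → Prop}
    (h : ∀ j, R.Honest j → ∀ᶠ t in atTop, P j t) :
    ∀ᶠ t in atTop, ∀ j, R.Honest j → P j t :=
  eventually_all.mpr fun j => eventually_imp_distrib_left.mpr (h j)

theorem IsCommittee.eventually_suggestFrom (hC : R.IsCommittee C)
    (hs : ∀ j, R.Honest j → R.Suggests j) (hi : R.Honest i) :
    ∀ᶠ t in atTop, 2 * f + 1 ≤ (R.loc i t).suggestFrom.card := by
  refine (eventually_forall_honest (R := R) (P := fun j t => j ∈ (R.loc i t).suggestFrom)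
    fun j hj => ?_).mono fun t => card_le_of_forall_honest (R := R)
  obtain ⟨l, m, ρ, hv, t, h⟩ := hs j hj
  obtain ⟨t', ht'⟩ := hC.receive_suggestion hi hj (h i)
  filter_upwards [eventually_le i (t' + 1)] with t h
  exact h.suggestFrom (by rw [loc_succ ht']; exact R.mem_suggestFrom_effect i j _ hv)

/-! ## Votes and binary agreement -/

theorem isSome_mono {α : Type*} {x y : Option α} (h : ∀ a, x = some a → y = some a)
    (hx : x.isSome = true) : y.isSome = true := by
  obtain ⟨a, ha⟩ := Option.isSome_iff_exists.mp hx
  exact Option.isSome_iff_exists.mpr ⟨a, h a ha⟩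

theorem IsCommittee.eventually_vote (hC : R.IsCommittee C)
    (hs : ∀ j, R.Honest j → R.Suggests j) (hl : l ∈ C) (hi : R.Honest i) :
    ∀ᶠ t in atTop, ((R.loc i t).inst l).vote.isSome = true := by
  refine eventually_loc_of_fair (e := .voteZero l) (P := fun s => (s.inst l).vote.isSome = true)
    hi trivial (by simp) (fun s s' h => isSome_mono (h.inst l).vote) ?_
    fun s hs => by simp [Config.effect]
  filter_upwards [hC i hi, hC.eventually_suggestFrom hs hi] with t h h' hn
  exact ⟨⟨C, h, hl⟩, h', by simpa using hn⟩

theorem vote_of_sent (hj : R.Honest j) {msg : Option (E.Cipher × Proof)}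
    (h : (j, k, .vote l msg) ∈ (R.state t).sent) :
    ((R.loc j t).inst l).vote = some msg.isSome ∧ ∀ m ρ, msg = some (m, ρ) → R.verify l m ρ := by
  obtain ⟨t', ht, e, he, hp⟩ := exists_act_of_sent hj h
  obtain ⟨h₁, h₂⟩ := R.mem_effect_vote hp
  rw [← loc_succ he] at h₁
  exact ⟨((loc_le ht).inst l).vote _ h₁, h₂⟩

theorem IsCommittee.eventually_voters (hC : R.IsCommittee C)
    (hs : ∀ j, R.Honest j → R.Suggests j) (hl : l ∈ C) (hi : R.Honest i) :
    ∀ᶠ t in atTop, 2 * f + 1 ≤ ((R.loc i t).inst l).voters.card := by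
  refine (eventually_forall_honest (R := R) (P := fun j t => j ∈ ((R.loc i t).inst l).voters)
    fun j hj => ?_).mono fun t => card_le_of_forall_honest (R := R)
  obtain ⟨t, ht⟩ := (hC.eventually_vote hs hl hj).exists
  obtain ⟨b, hb⟩ := Option.isSome_iff_exists.mp ht
  obtain ⟨msg, h⟩ := sent_vote_of_vote hb
  obtain ⟨t', ht'⟩ := occurs_receive hi hj (h i) (hC.eventually_vote hs hl hi)
  filter_upwards [eventually_le i (t' + 1)] with t h'
  refine (h'.inst l).voters ?_
  rw [loc_succ ht']
  exact R.mem_voters_effect i j _ (vote_of_sent hj (h i)).2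

theorem IsCommittee.exists_abbaIn (hC : R.IsCommittee C)
    (hs : ∀ j, R.Honest j → R.Suggests j) (hl : l ∈ C) (hi : R.Honest i) :
    ∃ t b, ((R.loc i t).inst l).abbaIn = some b := by
  -- Fairness concerns one fixed event, but the bit to be input may switch. As `u` can never return
  -- from `true` to `false`, it is eventually constant, and its final value names the event.
  have hu : ∃ b, ∀ᶠ t in atTop, ((R.loc i t).inst l).u = b := by
    by_cases h : ∃ t, ((R.loc i t).inst l).u = true
    · obtain ⟨t, h⟩ := h
      exact ⟨true, (eventually_le i t).mono fun t' h' => (h'.inst l).u h⟩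
    · exact ⟨false, .of_forall fun t => by simpa using not_exists.mp h t⟩
  obtain ⟨b, hu⟩ := hu
  have h : ∀ᶠ t in atTop, ((R.loc i t).inst l).abbaIn.isSome = true := by
    refine eventually_loc_of_fair (e := .abbaIn l b) (P := fun s => (s.inst l).abbaIn.isSome = true)
      hi trivial (by simp) (fun s s' h => isSome_mono (h.inst l).abbaIn) ?_
      fun s hs => by simp [Config.effect]
    filter_upwards [hu, hC.eventually_vote hs hl hi, hC.eventually_voters hs hl hi] with t h h' h'' hn
    exact ⟨h', h'', by simpa using hn, h.symm⟩
  obtain ⟨t, ht⟩ := h.exists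
  exact ⟨t, Option.isSome_iff_exists.mp ht⟩

theorem Secure.exists_abbaOut (hS : R.Secure) (hC : R.IsCommittee C)
    (hs : ∀ j, R.Honest j → R.Suggests j) (hl : l ∈ C) :
    ∃ b, ∀ i, R.Honest i → ∀ᶠ t in atTop, ((R.loc i t).inst l).abbaOut = some b := by
  have key := (hS.abba l).termination fun i hi => by
    obtain ⟨t, b, h⟩ := hC.exists_abbaIn hs hl hi
    exact ⟨b, occurs_abbaIn h⟩
  obtain ⟨i₀, -, hi₀⟩ := exists_honest_of_card (R := R) (S := R.faultyᶜ)
    (by have := R.card_compl_faulty; omega)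
  obtain ⟨b, hb⟩ := key i₀ hi₀
  refine ⟨b, fun i hi => ?_⟩
  obtain ⟨b', hb'⟩ := key i hi
  obtain rfl := (hS.abba l).agreement i i₀ b' b hi hi₀ hb' hb
  obtain ⟨t, ht⟩ := hb'
  filter_upwards [eventually_le i (t + 1)] with t' h
  exact (h.inst l).abbaOut b' (by rw [loc_succ ht]; simp [Config.effect])

/-! ## Retrieving and decrypting -/

/-- By validity of ABBA some honest party input `1`; its `u` was then set, so it holds the proposal
and answers the request. A party that lacks the proposal for ever would send this request and store
the reply. -/
theorem Secure.eventually_msg (hS : R.Secure)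
    (ho : ∀ i, R.Honest i → ∀ᶠ t in atTop, ((R.loc i t).inst l).abbaOut = some true)
    (hi : R.Honest i) : ∀ᶠ t in atTop, ((R.loc i t).inst l).msg.isSome = true := by
  have mono : ∀ j t, ((R.loc j t).inst l).msg.isSome = true →
      ∀ᶠ t in atTop, ((R.loc j t).inst l).msg.isSome = true := fun j t h =>
    (eventually_le j t).mono fun t' h' => (h'.inst l).msg h
  by_contra hcon
  have hn : ∀ t, ((R.loc i t).inst l).msg = none := fun t => by
    by_contra h
    exact hcon (mono i t (Option.isSome_iff_ne_none.mpr h))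
  have hf : ∀ᶠ t in atTop, ((R.loc i t).inst l).fetched = true := by
    refine eventually_loc_of_fair (e := .fetch l) (P := fun s => (s.inst l).fetched = true)
      hi trivial (by simp) (fun s s' h => (h.inst l).fetched) ?_
      fun s hs => by simp [Config.effect]
    filter_upwards [ho i hi] with t h h'
    exact ⟨h, hn t, by simpa using h'⟩
  obtain ⟨t₁, h₁⟩ := hf.exists
  obtain ⟨t₂, h₂⟩ := (ho i hi).exists
  obtain ⟨j, hj, t₃, h₃⟩ := (hS.abba l).validity i true hi (occurs_abbaOut h₂)
  have hm : ((R.loc j t₃).inst l).msg.isSome = true :=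
    ((R.inv j t₃).inst l).msg_of_u (enabled_of_act h₃).2.2.2.symm
  obtain ⟨t₄, h₄⟩ := occurs_receive hj hi (sent_fetch_of_fetched h₁ j) (mono j t₃ hm)
  obtain ⟨⟨m, ρ⟩, hm⟩ := Option.isSome_iff_exists.mp (enabled_of_act h₄)
  have hsent : (j, i, .reply l m ρ) ∈ (R.state (t₄ + 1)).sent := sent_succ h₄ ⟨m, ρ, hm, rfl⟩
  obtain ⟨t₅, h₅⟩ := occurs_receive hi hj hsent (ho i hi)
  have := R.msg_effect_reply i j (R.loc i t₅) (produced_of_msg hm).1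
  rw [← loc_succ h₅, hn] at this
  exact Bool.false_ne_true this

theorem Secure.exists_produced (hS : R.Secure)
    (ho : ∀ i, R.Honest i → ∀ᶠ t in atTop, ((R.loc i t).inst l).abbaOut = some true) :
    ∃ m, (∃ ρ, R.Produced l m ρ) ∧ ∀ i, R.Honest i →
      ∀ᶠ t in atTop, ∃ ρ, ((R.loc i t).inst l).msg = some (m, ρ) := by
  obtain ⟨i₀, -, hi₀⟩ := exists_honest_of_card (R := R) (S := R.faultyᶜ)
    (by have := R.card_compl_faulty; omega)
  obtain ⟨t₀, h₀⟩ := (hS.eventually_msg ho hi₀).exists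
  obtain ⟨⟨m, ρ⟩, h₀⟩ := Option.isSome_iff_exists.mp h₀
  refine ⟨m, ⟨ρ, produced_of_msg h₀⟩, fun i hi => (hS.eventually_msg ho hi).mono fun t h => ?_⟩
  obtain ⟨⟨m', ρ'⟩, h⟩ := Option.isSome_iff_exists.mp h
  obtain rfl := hS.produced_unique (produced_of_msg h₀) (produced_of_msg h)
  exact ⟨ρ', h⟩

theorem Secure.eventually_shares (hS : R.Secure) (hE : E.Correct)
    (ho : ∀ i, R.Honest i → ∀ᶠ t in atTop, ((R.loc i t).inst l).abbaOut = some true)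
    (hi : R.Honest i) (hj : R.Honest j) :
    ∀ᶠ t in atTop, (((R.loc i t).inst l).shares j).isSome = true := by
  obtain ⟨m, ⟨ρ, hp⟩, hm⟩ := hS.exists_produced ho
  obtain ⟨σ, hσ⟩ := Option.isSome_iff_exists.mp
    ((hE.decShare_isSome _ _ m j R.keys).mpr (hS.valid_of_produced hp).1)
  have hsent : ∀ᶠ t in atTop, ((R.loc j t).inst l).shareSent = true := by
    refine eventually_loc_of_fair (e := .share l σ) (P := fun s => (s.inst l).shareSent = true)
      hj trivial (by simp) (fun s s' h => (h.inst l).shareSent) ?_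
      fun s hs => by simp [Config.effect]
    filter_upwards [ho j hj, hm j hj] with t h ⟨ρ, h'⟩ hn
    exact ⟨h, by simpa using hn, m, ρ, h', hσ⟩
  obtain ⟨t₁, h₁⟩ := hsent.exists
  obtain ⟨m', ρ', σ', hp', hσ', h⟩ := sent_share_of_shareSent h₁
  obtain rfl := hS.produced_unique hp hp'
  obtain ⟨t₂, h₂⟩ := occurs_receive hi hj (h i) (by
    filter_upwards [ho i hi, hm i hi] with t h ⟨ρ, h'⟩
    exact ⟨h, by simp [h']⟩)
  obtain ⟨⟨m₂, ρ₂⟩, hm₂⟩ := Option.isSome_iff_exists.mp (enabled_of_act h₂).2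
  obtain rfl := hS.produced_unique hp (produced_of_msg hm₂)
  have := R.shares_effect_share i j (R.loc i t₂) hm₂
    (hE.decShare_verify _ _ m j σ' R.keys hσ')
  rw [← loc_succ h₂] at this
  exact (eventually_le i (t₂ + 1)).mono fun t h => isSome_mono ((h.inst l).shares j) this

theorem Secure.eventually_ret (hS : R.Secure) (hE : E.Correct) (hC : R.IsCommittee C)
    (hs : ∀ j, R.Honest j → R.Suggests j) (hl : l ∈ C) (hi : R.Honest i) :
    ∀ᶠ t in atTop, ((R.loc i t).inst l).ret.isSome = true := by
  obtain ⟨b, ho⟩ := hS.exists_abbaOut hC hs hl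
  cases b with
  | false =>
    exact (ho i hi).mono fun t h => by simp [((R.inv i t).inst l).ret_of_abbaOut h]
  | true =>
    obtain ⟨m, ⟨ρ, hp⟩, hm⟩ := hS.exists_produced ho
    have hw := (hS.valid_of_produced hp).1
    -- The event `combine l v` must be the same at all later times although the collected shares
    -- grow; `Secure.dec_eq` guarantees this for the plaintext of the full family.
    obtain ⟨v, hv⟩ := Option.isSome_iff_exists.mp
      (hE.dec_isSome _ _ m _ R.keys hw (validShares_allShares hE hw))
    refine eventually_loc_of_fair (e := .combine l v) (P := fun s => (s.inst l).ret.isSome = true)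
      hi trivial (by simp) (fun s s' h => isSome_mono (h.inst l).ret) ?_
      fun s hs => by simp [Config.effect]
    have hsh := eventually_forall_honest (R := R)
      (P := fun j t => (((R.loc i t).inst l).shares j).isSome = true)
      fun j hj => hS.eventually_shares hE ho hi hj
    filter_upwards [ho i hi, hm i hi, hsh] with t h ⟨ρ, h'⟩ h'' hn
    have hc : 2 * f + 1 ≤ (Finset.univ.filter fun j =>
        (((R.loc i t).inst l).shares j).isSome = true).card :=
      card_le_of_forall_honest (R := R) fun j hj => by simpa using h'' j hj
    have hc' := (show f + 1 ≤ 2 * f + 1 by omega).trans hc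
    exact ⟨h, by simpa using hn, hc', m, ρ, h', by rw [hS.dec_eq hE hp hc', hv]⟩

theorem Secure.exists_output (hS : R.Secure) (hE : E.Correct) (hC : R.IsCommittee C)
    (hs : ∀ j, R.Honest j → R.Suggests j) (hi : R.Honest i) :
    ∃ V, R.Occurs i (.output V) := by
  classical
  have hret : ∀ᶠ t in atTop, ∀ l ∈ C, ((R.loc i t).inst l).ret.isSome = true :=
    (Finset.eventually_all C).mpr fun l hl => hS.eventually_ret hE hC hs hl hi
  obtain ⟨T, hT⟩ := hret.exists
  -- Returned results are final, so the set formed at time `T` meets the guard of the output event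
  -- ever after. Joining and erasing discards the instances without a value.
  let V : Finset E.Plain := (C.image fun l => ((R.loc i T).inst l).ret.join).eraseNone
  have hV : ∀ v, v ∈ V ↔ ∃ l ∈ C, ((R.loc i T).inst l).ret = some (some v) := by
    simp [V, Option.join_eq_some_iff]
  have h : ∀ᶠ t in atTop, (R.loc i t).output.isSome = true := by
    refine eventually_loc_of_fair (e := .output V) (P := fun s => s.output.isSome = true)
      hi trivial (by simp) (fun s s' h => isSome_mono h.output) ?_ fun s hs => by simp [Config.effect]
    filter_upwards [hC i hi, hC.eventually_suggestFrom hs hi, eventually_le i T] with t h h' h'' hn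
    refine ⟨by simpa using hn, h', C, h, fun l hl => isSome_mono (h''.inst l).ret (hT l hl),
      fun v => (hV v).trans (exists_congr fun l => and_congr_right fun hl => ?_)⟩
    obtain ⟨r, hr⟩ := Option.isSome_iff_exists.mp (hT l hl)
    rw [hr, (h''.inst l).ret r hr]
  obtain ⟨t, ht⟩ := h.exists
  obtain ⟨V', hV'⟩ := Option.isSome_iff_exists.mp ht
  exact ⟨V', occurs_output hV'⟩

/-! ### Totality and agreement. -/

theorem Secure.totality (hS : R.Secure) (hE : E.Correct) : R.Totality := by
  rintro ⟨i, C, hi, hiC, hmem, hin⟩ j hj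
  obtain ⟨t, ht⟩ := (eventually_committee hiC).exists
  obtain ⟨C', hC⟩ := hS.exists_committee
  have := hS.suggests_of_proposes hi ⟨⟨C, ht, hmem⟩, hin⟩
  exact hS.exists_output hE hC (fun k hk => hS.suggests_of_suggests hC hi this hk) hj

theorem Secure.agreement (hS : R.Secure) (hE : E.Correct) : R.Agreement := by
  rintro i V hi ⟨t, ht⟩ j hj
  obtain ⟨C, hC⟩ := hS.exists_committee
  obtain ⟨-, hc, C', hC', hr, hV⟩ := enabled_of_act ht
  obtain rfl := hC.eq hi hC'
  obtain ⟨V', t', ht'⟩ := hS.exists_output hE hC (fun k hk => hS.suggests_of_card hC hc hk) hj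
  obtain ⟨-, -, C'', hC'', hr', hV'⟩ := enabled_of_act ht'
  obtain rfl := hC.eq hj hC''
  suffices V = V' from this ▸ ⟨t', ht'⟩
  ext v
  rw [hV, hV']
  refine exists_congr fun l => and_congr_right fun hl => ?_
  obtain ⟨r, hr⟩ := Option.isSome_iff_exists.mp (hr l hl)
  obtain ⟨r', hr'⟩ := Option.isSome_iff_exists.mp (hr' l hl)
  rw [hr, hr', hS.ret_unique hE hi hj hr hr']

end Run

/-! ## Non-emptiness of the output -/

/-- If each of at least `2f + 1` parties (the members of `H`) hears `2f + 1` of the `3f + 1`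
parties, then some member of `H` is heard by `f + 1` members of `H`. -/
theorem exists_heard {f : ℕ} (H : Finset (Party f)) (hH : 2 * f + 1 ≤ H.card)
    (S : Party f → Finset (Party f)) (hS : ∀ j ∈ H, 2 * f + 1 ≤ (S j).card) :
    ∃ p ∈ H, f + 1 ≤ (H.filter fun j => p ∈ S j).card := by
  by_contra! h
  have h₁ : ∑ p ∈ H, (H.filter fun j => p ∈ S j).card ≤ H.card * f :=
    (Finset.sum_le_card_nsmul _ _ _ fun p hp => Nat.le_of_lt_succ (h p hp)).trans_eq
      (smul_eq_mul _ _)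
  -- Each `S j` meets `H` in at least `(2f + 1) + (2f + 1) - (3f + 1) = f + 1` parties. Counting the
  -- pairs in `H × H` both ways contradicts the bound `f` per heard party.
  have h₂ : H.card * (f + 1) ≤ ∑ j ∈ H, (H.filter fun p => p ∈ S j).card := by
    refine (smul_eq_mul _ _).symm.trans_le (Finset.card_nsmul_le_sum _ _ _ fun j hj => ?_)
    have h₃ := Finset.card_union_add_card_inter H (S j)
    have h₄ := Finset.card_le_univ (H ∪ S j)
    rw [Fintype.card_fin] at h₄
    have h₅ := hS j hj
    rw [Finset.filter_mem_eq_inter]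
    omega
  have h₃ := Finset.sum_card_bipartiteAbove_eq_sum_card_bipartiteBelow (s := H) (t := H)
    fun p j => p ∈ S j
  simp only [Finset.bipartiteAbove, Finset.bipartiteBelow] at h₃
  rw [h₃] at h₁
  have := h₂.trans h₁
  rw [Nat.mul_succ] at this
  omega

variable {f : ℕ} {E : ThresholdEncryption f} {Proof : Type}

namespace Run

open Filter

variable {Q : Party f → E.Cipher → Prop} {R : Run E Proof Q}
variable {i j k k' l l' : Party f} {t t' : ℕ} {m m' : E.Cipher} {ρ ρ' : Proof}
  {C : Finset (Party f)}

/-- An honest party does not suggest twice. -/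
theorem suggestion_unique (hi : R.Honest i)
    (h : (i, k, .suggestion l m ρ) ∈ (R.state t).sent)
    (h' : (i, k', .suggestion l' m' ρ') ∈ (R.state t').sent) : l = l' := by
  have once : ∀ {t t' e e' k k' l l' m m' ρ ρ'}, R.act t = .honest i e → R.act t' = .honest i e' →
      (k, .suggestion l m ρ) ∈ (R.effect i (R.loc i t) e).2 →
      (k', .suggestion l' m' ρ') ∈ (R.effect i (R.loc i t') e').2 → ¬ t < t' := by
    intro t t' e e' k k' l l' m m' ρ ρ' he he' h h' hlt
    have hs := (R.mem_effect_suggestion h).1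
    rw [← loc_succ he] at hs
    have hs' := (loc_le (R := R) (i := i) hlt).suggested hs
    -- A second suggestion would come either from a pPB return, although a proposer that has
    -- suggested has already had its return, or from a relay, which needs the flag to be unset.
    rcases (R.mem_effect_suggestion h').2 with ⟨rfl, -, -⟩ | ⟨-, hn, -⟩
    · obtain ⟨h₁, h₂⟩ := enabled_of_act he'
      have hinv := R.inv i t'
      rw [hinv.pbReturned_of_suggested hs' (hinv.proposes h₁)] at h₂
      exact Bool.false_ne_true h₂.symm
    · rw [hn] at hs'
      exact Bool.false_ne_true hs'
  obtain ⟨t₁, -, e₁, he₁, h₁⟩ := exists_act_of_sent hi h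
  obtain ⟨t₂, -, e₂, he₂, h₂⟩ := exists_act_of_sent hi h'
  have : t₁ = t₂ := by
    have := once he₁ he₂ h₁ h₂
    have := once he₂ he₁ h₂ h₁
    omega
  subst this
  obtain rfl : e₁ = e₂ := by
    rw [he₁] at he₂
    cases he₂
    rfl
  have a₁ := (R.mem_effect_suggestion h₁).2
  have a₂ := (R.mem_effect_suggestion h₂).2
  grind

/-- An honest party votes `1` for the suggestions of a quorum. -/
theorem exists_quorum_voted (hc : 2 * f + 1 ≤ (R.loc i t).suggestFrom.card) :
    ∃ S : Finset (Party f), 2 * f + 1 ≤ S.card ∧ ∀ j ∈ S, R.Honest j →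
      ∀ l m ρ k t, (j, k, .suggestion l m ρ) ∈ (R.state t).sent →
        ∃ t', ((R.loc i t').inst l).vote = some true := by
  classical
  have hex : ∃ t, 2 * f + 1 ≤ (R.loc i t).suggestFrom.card := ⟨t, hc⟩
  -- At the first time with `2f + 1` counted suggestions no vote for `0` can have been cast, since
  -- such a vote needs an earlier time with as many.
  refine ⟨(R.loc i (Nat.find hex)).suggestFrom, Nat.find_spec hex, fun j hj hjh l m ρ k t h => ?_⟩
  obtain ⟨l', m', ρ', -, h', hv⟩ := sent_of_mem_suggestFrom hj
  obtain rfl := suggestion_unique hjh h h'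
  refine ⟨Nat.find hex, ?_⟩
  obtain ⟨b, hb⟩ := Option.isSome_iff_exists.mp hv
  cases b with
  | true => exact hb
  | false =>
    obtain ⟨t', ht', hc', -⟩ := suggestFrom_card_of_vote hb
    exact absurd hc' (Nat.find_min hex ht')

/-- If `f + 1` honest parties vote `1` then all honest inputs to the binary agreement are `1`. -/
theorem abbaIn_eq_true {T : Finset (Party f)} (hT : f + 1 ≤ T.card)
    (hT' : ∀ j ∈ T, R.Honest j ∧ ∃ t, ((R.loc j t).inst l).vote = some true) {b : Bool}
    (h : ((R.loc i t).inst l).abbaIn = some b) : b = true := by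
  obtain ⟨t', -, hc, rfl⟩ := voters_card_of_abbaIn h
  -- The sets meet because `(2f + 1) + (f + 1) > 3f + 1`.
  obtain ⟨j, hj⟩ : (((R.loc i t').inst l).voters ∩ T).Nonempty := by
    have h₁ := Finset.card_union_add_card_inter ((R.loc i t').inst l).voters T
    have h₂ := Finset.card_le_univ (((R.loc i t').inst l).voters ∪ T)
    rw [Fintype.card_fin] at h₂
    exact Finset.card_pos.mp (by omega)
  obtain ⟨hjv, hjT⟩ := Finset.mem_inter.mp hj
  obtain ⟨msg, hs, hu⟩ := sent_of_mem_voters hjv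
  obtain ⟨hjh, t₁, h₁⟩ := hT' j hjT
  refine hu ?_
  -- The vote of an honest party never changes, so what was counted from `j` is its vote `1`, and
  -- this set `u`.
  have h₂ := (vote_of_sent hjh hs).1
  have h₃ := ((loc_le (R := R) (i := j) (le_max_left t₁ t')).inst l).vote _ h₁
  have h₄ := ((loc_le (R := R) (i := j) (le_max_right t₁ t')).inst l).vote _ h₂
  exact (Option.some_injective _ (h₃.symm.trans h₄)).symm

/-- Some instance of the binary agreement decides `1`. -/
theorem Secure.exists_abbaOut_true (hS : R.Secure) (hC : R.IsCommittee C)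
    (hs : ∀ j, R.Honest j → R.Suggests j) :
    ∃ l ∈ C, ∀ i b, R.Honest i → R.Occurs i (.abbaOut l b) → b = true := by
  have hq : ∀ i, ∃ S : Finset (Party f), R.Honest i → 2 * f + 1 ≤ S.card ∧
      ∀ j ∈ S, R.Honest j → ∀ l m ρ k t, (j, k, .suggestion l m ρ) ∈ (R.state t).sent →
        ∃ t', ((R.loc i t').inst l).vote = some true := fun i => by
    by_cases hi : R.Honest i
    · obtain ⟨t, ht⟩ := (hC.eventually_suggestFrom hs hi).exists
      obtain ⟨S, hS⟩ := exists_quorum_voted ht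
      exact ⟨S, fun _ => hS⟩
    · exact ⟨∅, fun h => absurd h hi⟩
  choose S hq using hq
  obtain ⟨p, hp, hT⟩ := exists_heard R.faultyᶜ R.card_compl_faulty S
    fun j hj => (hq j (mem_compl_faulty.mp hj)).1
  have hp := mem_compl_faulty.mp hp
  obtain ⟨l, m, ρ, hv, t, h⟩ := hs p hp
  -- The packet of `p` to itself witnesses that a valid proof was sent. Membership in the committee
  -- makes every honest party take part in this instance.
  have hl : l ∈ C := hS.mem_of_produced hC ⟨hv, t, p, p, _, h p, rfl, rfl, rfl⟩
  refine ⟨l, hl, (hS.abba l).biased ?_⟩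
  refine (show f + 1 ≤ 2 * f + 1 by omega).trans (R.card_compl_faulty.trans
    (card_le_honestCount _ fun i hi => ?_))
  have hi := mem_compl_faulty.mp hi
  refine ⟨hi, ?_⟩
  obtain ⟨t', b, hb⟩ := hC.exists_abbaIn hs hl hi
  obtain rfl := abbaIn_eq_true hT (fun j hj => by
    obtain ⟨hj, hpj⟩ := Finset.mem_filter.mp hj
    have hj := mem_compl_faulty.mp hj
    exact ⟨hj, (hq j hj).2 p hpj hp l m ρ p t (h p)⟩) hb
  exact occurs_abbaIn hb

theorem Secure.validity (hS : R.Secure) (hE : E.Correct) : R.Validity := by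
  rintro i V hi ⟨t, ht⟩
  obtain ⟨C, hC⟩ := hS.exists_committee
  obtain ⟨-, hc, C', hC', hr, hV⟩ := enabled_of_act ht
  obtain rfl := hC.eq hi hC'
  refine ⟨?_, fun v hv => ?_⟩
  · obtain ⟨l, hl, h⟩ := hS.exists_abbaOut_true hC fun j hj => hS.suggests_of_card hC hc hj
    obtain ⟨r, hr⟩ := Option.isSome_iff_exists.mp (hr l hl)
    have := h i _ hi (occurs_abbaOut (((R.inv i t).inst l).abbaOut_of_ret r hr))
    obtain ⟨v, rfl⟩ := Option.isSome_iff_exists.mp this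
    exact Finset.card_pos.mpr ⟨v, (hV v).mpr ⟨l, hl, hr⟩⟩
  · obtain ⟨l, hl, hv⟩ := (hV v).mp hv
    obtain ⟨m, ρ, hp, hd⟩ := hS.exists_dec_of_ret hE hv
    refine ⟨C', l, m, ρ, hC.occurs hi, hl, hp, hS.valid_of_produced hp, hd, fun hlh => ?_⟩
    -- Selectedness shows that an honest `l` invoked pPB with this ciphertext, hence that it
    -- encrypts the input of `l`.
    obtain ⟨v', hv', rfl⟩ := hS.input_of_produced hp hlh
    rw [hv', ← hd]
    exact (hE.dec_enc _ _ _ _ _ R.keys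
      (validShares_allShares hE (hS.valid_of_produced hp).1)).symm

end Run

/-! ## Negligible probability -/

section Probability

variable {g : ℕ → ℕ} {Ω : ℕ → Type} [∀ k, MeasurableSpace (Ω k)]
  {μ : ∀ k, Measure (Ω k)} [∀ k, IsProbabilityMeasure (μ k)]

theorem ExceptNegligible.mono {P P' : ∀ k, Ω k → Prop} (h : ExceptNegligible μ P)
    (hP : ∀ k ω, P k ω → P' k ω) : ExceptNegligible μ P' := by
  refine Asymptotics.SuperpolynomialDecay.trans_abs_le h fun k => ?_
  rw [abs_of_nonneg measureReal_nonneg, abs_of_nonneg measureReal_nonneg]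
  exact measureReal_mono fun ω hω h => hω (hP k ω h)

/-- Monotonicity and subadditivity of a measure hold for arbitrary sets, so the events need not be
measurable. -/
theorem ExceptNegligible.and {P P' : ∀ k, Ω k → Prop} (h : ExceptNegligible μ P)
    (h' : ExceptNegligible μ P') : ExceptNegligible μ fun k ω => P k ω ∧ P' k ω := by
  refine Asymptotics.SuperpolynomialDecay.trans_abs_le (h.add h') fun k => ?_
  rw [abs_of_nonneg measureReal_nonneg]
  refine le_trans ?_ (le_abs_self _)
  refine le_trans (measureReal_mono fun ω hω => ?_) (measureReal_union_le _ _)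
  exact not_and_or.mp hω

/-- Polynomially many instances hold simultaneously. -/
theorem EachExceptNegligible.forall (hg : ∃ c : ℕ, ∀ k, g k ≤ k ^ c + c)
    {P : ∀ k, Party (g k) → Ω k → Prop} (h : EachExceptNegligible μ P) :
    ExceptNegligible μ fun k ω => ∀ l, P k l ω := by
  obtain ⟨c, hc⟩ := hg
  obtain ⟨ν, hν, hP⟩ := h
  -- The polynomial bounds the number `3 * g k + 1` of instances. The bound `ν` is non-negative
  -- because party `0` always exists.
  refine Asymptotics.SuperpolynomialDecay.trans_abs_le
    (hν.mul_polynomial (3 * (Polynomial.X ^ c + Polynomial.C (c : ℝ)) + 1)) fun k => ?_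
  rw [abs_of_nonneg measureReal_nonneg]
  refine le_trans ?_ (le_abs_self _)
  have hν0 : 0 ≤ ν k := measureReal_nonneg.trans (hP k 0)
  calc (μ k).real {ω | ¬ ∀ l, P k l ω}
      ≤ (μ k).real (⋃ l, {ω | ¬ P k l ω}) :=
        measureReal_mono fun ω hω => Set.mem_iUnion.mpr (not_forall.mp hω)
    _ ≤ ∑ l, (μ k).real {ω | ¬ P k l ω} := measureReal_iUnion_fintype_le _
    _ ≤ ∑ _l : Party (g k), ν k := Finset.sum_le_sum fun l _ => hP k l
    _ = ν k * (3 * g k + 1) := by simp [mul_comm]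
    _ ≤ _ := by
      refine mul_le_mul_of_nonneg_left ?_ hν0
      have : (g k : ℝ) ≤ (k : ℝ) ^ c + c := by exact_mod_cast hc k
      simp only [Polynomial.eval_add, Polynomial.eval_mul, Polynomial.eval_pow, Polynomial.eval_X,
        Polynomial.eval_C, Polynomial.eval_one, Polynomial.eval_ofNat]
      linarith

end Probability

end SlimABC

/-! ### Reduction to executions with secure sub-protocols. -/

open SlimABC in
theorem mainTheorem1
    (f : ℕ → ℕ) (hf : ∃ c : ℕ, ∀ k, f k ≤ k ^ c + c)
    (E : ∀ k, ThresholdEncryption (f k)) (hE : ∀ k, (E k).Correct)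
    (Proof : Type) (Q : ∀ k, Party (f k) → (E k).Cipher → Prop)
    (Ω : ℕ → Type) [∀ k, MeasurableSpace (Ω k)]
    (μ : ∀ k, MeasureTheory.Measure (Ω k)) [∀ k, MeasureTheory.IsProbabilityMeasure (μ k)]
    (R : ∀ k, Ω k → Run (E k) Proof (Q k))
    (hCS : ExceptNegligible μ fun k ω => (R k ω).CommitteeSecure)
    (hPB : EachExceptNegligible μ fun k l ω => (R k ω).PBSecure l)
    (hABBA : EachExceptNegligible μ fun k l ω => (R k ω).ABBASecure l) :
    ExceptNegligible μ (fun k ω => (R k ω).Agreement) ∧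
      ExceptNegligible μ (fun k ω => (R k ω).Validity) ∧
      ExceptNegligible μ (fun k ω => (R k ω).Totality) := by
  have hS : ExceptNegligible μ fun k ω => (R k ω).Secure :=
    (hCS.and ((hPB.forall hf).and (hABBA.forall hf))).mono fun k ω h => ⟨h.1, h.2.1, h.2.2⟩
  exact ⟨hS.mono fun k ω h => h.agreement (hE k), hS.mono fun k ω h => h.validity (hE k),
    hS.mono fun k ω h => h.totality (hE k)⟩
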